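/- Work in first-order logic over the language $\{\in\}$, and write $T\vdash\varphi$ when the sentence $\varphi$ is a consequence of the theory $T$, i.e. holds in every (not necessarily well-founded) model of $T$; by Gödel's completeness theorem this is the same as provability. Let BST consist of the axioms Empty Set, Extensionality, Pair, Union, Cartesian Product, "$\omega$ exists", and the schema of $\Delta_0$-Separation. Let LZFC be BST together with the axiom $Loc(\mathrm{ZFC}):\ \forall x\,\exists y\,(x\in y \wedge y\text{ is transitive} \wedge (y,\in)\models \mathrm{ZFC})$, where $\models$ is the satisfaction relation for set structures, formalized in the language of set theory (LZFC has no axiom of Powerset, Replacement or full Separation for the universe). Let $\kappa,\alpha,\delta$ range over ordinals and $M$ over transitive sets with $(M,\in)\models\mathrm{ZFC}$; $|a|\le|b|$ means that there is an injection from $a$ to $b$, and $|a|<|b|$ means $|a|\le|b|$ and not $|b|\le|a|$. Consider the sentences $GC$: $\exists\kappa\,\forall y\,(|y|\le|\kappa|)$; $TMA$: $\forall\kappa\,\exists\alpha>\kappa\,\forall\delta\ge\alpha\,\exists M\,(\delta\in M \wedge M\models|\kappa|<|\alpha|)$; $V=L$: $\forall x\,\exists\alpha\,(x\in L_\alpha)$,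 where $L_0=\emptyset$, $L_{\eta+1}=\mathrm{Def}(L_\eta)$ is the set of subsets of $L_\eta$ first-order definable over $(L_\eta,\in)$ with parameters, $L_\gamma=\bigcup_{\eta<\gamma}L_\eta$ for limit $\gamma$, and $x\in L_\alpha$ says that a function with domain $\alpha+1$ satisfying these clauses exists and $x$ belongs to its value at $\alpha$; and "every set is countable": $\forall x\,(|x|\le\omega)$. Then: (1) $\mathrm{LZFC}+GC+V{=}L\vdash\neg TMA$; (2) in particular, $\mathrm{LZFC}+\text{"every set is countable"}+V{=}L\vdash\neg TMA$; (3) $\mathrm{LZFC}+V{=}L\vdash\neg TMA\leftrightarrow GC$. -/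

import Mathlib

open FirstOrder

/-! First-order set theory inside an arbitrary structure for the language of set theory.
All formulas below are honest first-order formulas over one binary relation symbol. -/

namespace LocalZFC

/-- The only symbol of the language of set theory: a binary relation symbol. -/
inductive MemRel : ℕ → Type
  | mem : MemRel 2

/-- The language of set theory. -/
def setLang : FirstOrder.Language.{0, 0} := ⟨fun _ => Empty, MemRel⟩

/-- The symbol `∈` -/
def memRel : setLang.Relations 2 := MemRel.mem

/-- Formulas of set theory whose free variables are indexed by `Fin n`. -/
abbrev Fml (n : ℕ) := setLang.BoundedFormula Empty n

section Formulas

/-- A variable of a context is also a variable of every larger context. -/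
local instance liftVar {n : ℕ} : Coe (Fin n) (Fin (n + 1)) := ⟨Fin.castSucc⟩

variable {n : ℕ}

/-- `x ∈ y` -/
def mem (x y : Fin n) : Fml n :=
  memRel.boundedFormula₂ (&x) (&y)

/-- `x = y` -/
def eq (x y : Fin n) : Fml n :=
  FirstOrder.Language.Term.bdEqual (L := setLang) (&x) (&y)

infix:75 " ∈ₛ " => mem
infix:75 " =ₛ " => eq

/-- `∀ x, f x` -/
def all (f : Fin (n + 1) → Fml (n + 1)) : Fml n := ∀' (f (Fin.last n))

/-- `∃ x, f x` -/
def ex (f : Fin (n + 1) → Fml (n + 1)) : Fml n := ∃' (f (Fin.last n))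

/-- `∀ z ∈ x, f z` -/
def ball (x : Fin n) (f : Fin (n + 1) → Fml (n + 1)) : Fml n := all fun z => z ∈ₛ x ⟹ f z

/-- `∃ z ∈ x, f z` -/
def bex (x : Fin n) (f : Fin (n + 1) → Fml (n + 1)) : Fml n := ∼(ball x fun z => ∼(f z))

/-- The `Δ₀` formulas: the quantifiers are all bounded, `∀ z ∈ x`
(the connectives `¬, ∧, ∨` and the quantifier `∃ z ∈ x` are defined from these). -/
inductive IsDelta0 : ∀ {n : ℕ}, Fml n → Prop
  | falsum {n : ℕ} : IsDelta0 (⊥ : Fml n)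
  | mem {n : ℕ} (x y : Fin n) : IsDelta0 (x ∈ₛ y)
  | eq {n : ℕ} (x y : Fin n) : IsDelta0 (x =ₛ y)
  | imp {n : ℕ} {φ ψ : Fml n} : IsDelta0 φ → IsDelta0 ψ → IsDelta0 (φ ⟹ ψ)
  | ball {n : ℕ} (x : Fin n) {φ : Fml (n + 1)} : IsDelta0 φ → IsDelta0 (ball x fun _ => φ)

/-- Renaming of the free variables along `f`. -/
def rename : ∀ {n m : ℕ}, (Fin n → Fin m) → Fml n → Fml m
  | _, _, _, .falsum => .falsum
  | _, _, f, .equal s t => .equal (s.relabel (Sum.map id f)) (t.relabel (Sum.map id f))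
  | _, _, f, .rel R ts => .rel R fun i => (ts i).relabel (Sum.map id f)
  | _, _, f, .imp φ ψ => .imp (rename f φ) (rename f ψ)
  | _, m, f, .all φ => .all (rename (Fin.snoc (fun i => (f i).castSucc) (Fin.last m)) φ)

/-- The relativization `φ^M`: all quantifiers of `φ` are restricted to the elements of `M`.
For a transitive set `M` this says `(M, ∈) ⊨ φ`. -/
def relativize : ∀ {n : ℕ}, Fin n → Fml n → Fml n
  | _, _, .falsum => .falsum
  | _, _, .equal s t => .equal s t
  | _, _, .rel R ts => .rel R ts
  | _, M, .imp φ ψ => .imp (relativize M φ) (relativize M ψ)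
  | _, M, .all φ => ball M fun _ => relativize M.castSucc φ

/-! ### Elementary notions -/

/-- `x ⊆ y` -/
def subset (x y : Fin n) : Fml n := ball x fun z => z ∈ₛ y

/-- `x = ∅` -/
def isEmpty (x : Fin n) : Fml n := ball x fun _ => ⊥

/-- `y = x ∪ {x}` -/
def isSucc (y x : Fin n) : Fml n :=
  x ∈ₛ y ⊓ subset x y ⊓ ball y fun z => z ∈ₛ x ⊔ z =ₛ x

/-- `p = {x, y}` -/
def isUPair (p x y : Fin n) : Fml n :=
  x ∈ₛ p ⊓ y ∈ₛ p ⊓ ball p fun z => z =ₛ x ⊔ z =ₛ y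

/-- `p = (x, y)`, the Kuratowski pair `{{x}, {x, y}}` -/
def isPair (p x y : Fin n) : Fml n :=
  bex p fun u => bex p fun v => isUPair u x x ⊓ isUPair v x y ⊓ isUPair p u v

/-- `(x, y) ∈ f` -/
def pairMem (x y f : Fin n) : Fml n := bex f fun p => isPair p x y

/-- `x` is transitive. -/
def isTrans (x : Fin n) : Fml n := ball x fun y => subset y x

/-- `x` is an ordinal: transitive and linearly ordered by `∈`
(well-foundedness of `∈` on `x` is the axiom of regularity). -/
def isOrd (x : Fin n) : Fml n :=
  isTrans x ⊓ ball x fun y => ball x fun z => y ∈ₛ z ⊔ y =ₛ z ⊔ z ∈ₛ y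

/-- `x` is `∅` or a successor. -/
def isZeroOrSucc (x : Fin n) : Fml n := isEmpty x ⊔ bex x fun y => isSucc x y

/-- `x` is a natural number: an ordinal such that it and all its elements are `∅` or successors. -/
def isNat (x : Fin n) : Fml n :=
  isOrd x ⊓ isZeroOrSucc x ⊓ ball x fun y => isZeroOrSucc y

/-- `w = ω` -/
def isOmega (w : Fin n) : Fml n := all fun x => x ∈ₛ w ⇔ isNat x

/-- `f` is a function from `a` to `b`. -/
def isFun (f a b : Fin n) : Fml n :=
  (ball f fun p => bex a fun x => bex b fun y => isPair p x y) ⊓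
  (ball a fun x => bex b fun y => pairMem x y f) ⊓
  (ball a fun x => ball b fun y => ball b fun z => (pairMem x y f ⊓ pairMem x z f) ⟹ y =ₛ z)

/-- `f` is an injective function from `a` to `b`. -/
def isInj (f a b : Fin n) : Fml n :=
  isFun f a b ⊓
  ball a fun x => ball a fun y => ball b fun z => (pairMem x z f ⊓ pairMem y z f) ⟹ x =ₛ y

/-- `|a| ≤ |b|` -/
def cardLE (a b : Fin n) : Fml n := ex fun f => isInj f a b

/-- `|a| < |b|` -/
def cardLT (a b : Fin n) : Fml n := cardLE a b ⊓ ∼(cardLE b a)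

/-! ### The single axioms of ZFC -/

def axEmpty : Fml n := ex fun x => isEmpty x

def axExt : Fml n := all fun x => all fun y => (all fun z => z ∈ₛ x ⇔ z ∈ₛ y) ⟹ x =ₛ y

def axPair : Fml n := all fun x => all fun y => ex fun p => isUPair p x y

def axUnion : Fml n :=
  all fun x => ex fun u => all fun z => z ∈ₛ u ⇔ ex fun y => y ∈ₛ x ⊓ z ∈ₛ y

def axPower : Fml n :=
  all fun x => ex fun p => all fun z => z ∈ₛ p ⇔ subset z x

def axInfinity : Fml n :=
  ex fun w => (ex fun e => isEmpty e ⊓ e ∈ₛ w) ⊓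
    all fun x => x ∈ₛ w ⟹ ex fun y => isSucc y x ⊓ y ∈ₛ w

def axFoundation : Fml n :=
  all fun x => ∼(isEmpty x) ⟹ ex fun y => y ∈ₛ x ⊓ ∼(ex fun z => z ∈ₛ y ⊓ z ∈ₛ x)

/-- Choice: every set of nonempty pairwise disjoint sets has a transversal. -/
def axChoice : Fml n :=
  all fun x =>
    ((all fun y => y ∈ₛ x ⟹ ∼(isEmpty y)) ⊓
     (all fun y => all fun z => all fun u =>
        (y ∈ₛ x ⊓ z ∈ₛ x ⊓ u ∈ₛ y ⊓ u ∈ₛ z) ⟹ y =ₛ z)) ⟹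
    ex fun c => all fun y => y ∈ₛ x ⟹
      ex fun u => u ∈ₛ y ⊓ u ∈ₛ c ⊓ all fun v => (v ∈ₛ y ⊓ v ∈ₛ c) ⟹ v =ₛ u

/-! ### Satisfaction, formalized inside set theory

Inside the universe, formulas are coded by sets. Variables are the natural numbers, and a code of
arity `m` stands for a formula with free variables among `0, …, m - 1`; the codes are
`⌜xᵢ ∈ xⱼ⌝ = (0, (i, j))`, `⌜xᵢ = xⱼ⌝ = (1, (i, j))`, `⌜¬ φ⌝ = (2, φ)`, `⌜φ ∧ ψ⌝ = (3, (φ, ψ))`, and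
`⌜∃ xₘ φ⌝ = (4, φ)`, which has arity `m` when `φ` has arity `m + 1`. -/

/-- `x = 1` -/
def isOne (x : Fin n) : Fml n := bex x fun y => isEmpty y ⊓ isSucc x y

/-- `x = 2` -/
def isTwo (x : Fin n) : Fml n := bex x fun y => isOne y ⊓ isSucc x y

/-- `x = 3` -/
def isThree (x : Fin n) : Fml n := bex x fun y => isTwo y ⊓ isSucc x y

/-- `x = 4` -/
def isFour (x : Fin n) : Fml n := bex x fun y => isThree y ⊓ isSucc x y

/-- `c = ⌜xᵢ ∈ xⱼ⌝` -/
def codeMem (c i j : Fin n) : Fml n :=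
  ex fun t => ex fun q => isEmpty t ⊓ isPair q i j ⊓ isPair c t q

/-- `c = ⌜xᵢ = xⱼ⌝` -/
def codeEq (c i j : Fin n) : Fml n :=
  ex fun t => ex fun q => isOne t ⊓ isPair q i j ⊓ isPair c t q

/-- `c = ⌜¬ d⌝` -/
def codeNot (c d : Fin n) : Fml n := ex fun t => isTwo t ⊓ isPair c t d

/-- `c = ⌜d ∧ e⌝` -/
def codeAnd (c d e : Fin n) : Fml n :=
  ex fun t => ex fun q => isThree t ⊓ isPair q d e ⊓ isPair c t q

/-- `c = ⌜∃ xₘ d⌝`, where `d` has arity `m + 1` -/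
def codeEx (c d : Fin n) : Fml n := ex fun t => isFour t ⊓ isPair c t d

/-- `t = s ∪ {(m, a)}`: for a finite sequence `s` of length `m`, this says `t = s⌢a`. -/
def isSnoc (t s m a : Fin n) : Fml n :=
  subset s t ⊓ pairMem m a t ⊓ ball t fun p => p ∈ₛ s ⊔ isPair p m a

/-- `s⌢a ∈ R`, where `s` has length `m` -/
def snocMem (s m a R : Fin n) : Fml n := bex R fun t => isSnoc t s m a

/-- `s⌢a⌢b ∈ R`, where `s` has length `m` -/
def snocMem₂ (s m a b R : Fin n) : Fml n :=
  ex fun k => ex fun t => isSucc k m ⊓ isSnoc t s m a ⊓ snocMem t k b R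

/-- `R = {s : m → A | X s}` -/
def isRel (R m A : Fin n) (X : Fin (n + 1) → Fml (n + 1)) : Fml n :=
  all fun s => s ∈ₛ R ⇔ (isFun s m A ⊓ X s)

/-- `(i, (m, (c, R))) ∈ d` -/
def entry (d i m c R : Fin n) : Fml n :=
  ex fun q => ex fun e => isPair q c R ⊓ isPair e m q ⊓ pairMem i e d

/-- One step of a satisfaction sequence `d` for `(A, ∈)`, by Tarski's clauses: `c` is the code of an
atomic formula of arity `m`, or is built from codes of earlier entries of `d` (of index `j ∈ i`),
and `R` is the set of all `s : m → A` that satisfy it. -/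
def satStep (A d i m c R : Fin n) : Fml n :=
  (bex m fun x => bex m fun y => codeMem c x y ⊓
    isRel R m A fun s => bex A fun a => bex A fun b =>
      pairMem x a s ⊓ pairMem y b s ⊓ a ∈ₛ b) ⊔
  (bex m fun x => bex m fun y => codeEq c x y ⊓
    isRel R m A fun s => bex A fun a => pairMem x a s ⊓ pairMem y a s) ⊔
  (bex i fun j => ex fun c₁ => ex fun R₁ => entry d j m c₁ R₁ ⊓ codeNot c c₁ ⊓
    isRel R m A fun s => ∼(s ∈ₛ R₁)) ⊔
  (bex i fun j => bex i fun k => ex fun c₁ => ex fun R₁ => ex fun c₂ => ex fun R₂ =>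
    entry d j m c₁ R₁ ⊓ entry d k m c₂ R₂ ⊓ codeAnd c c₁ c₂ ⊓
    isRel R m A fun s => s ∈ₛ R₁ ⊓ s ∈ₛ R₂) ⊔
  (bex i fun j => ex fun m₁ => ex fun c₁ => ex fun R₁ =>
    isSucc m₁ m ⊓ entry d j m₁ c₁ R₁ ⊓ codeEx c c₁ ⊓
    isRel R m A fun s => bex A fun a => snocMem s m a R₁)

/-- `d` is a satisfaction sequence for `(A, ∈)`, of length `k ∈ ω`: a finite sequence of triples
`(m, (c, R))` each of which comes from earlier ones by Tarski's clauses. -/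
def isSatSeq (A d k : Fin n) : Fml n :=
  isNat k ⊓ (ex fun b => isFun d k b) ⊓
  ball k fun i => ex fun m => ex fun c => ex fun R =>
    entry d i m c R ⊓ isNat m ⊓ satStep A d i m c R

/-- `c` is the code of a formula of arity `m`, and `R = {s : m → A | (A, ∈) ⊨ c[s]}`. -/
def isSat (A m c R : Fin n) : Fml n :=
  ex fun d => ex fun k => isSatSeq A d k ⊓ bex k fun i => entry d i m c R

/-! ### Transitive models of ZFC -/

/-- `M` satisfies all instances of Separation, for all codes `c` and parameters `s` in `M`:
`∀ x ∃ y ∀ z (z ∈ y ↔ z ∈ x ∧ c(s, z))`. -/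
def satSeparation (M : Fin n) : Fml n :=
  all fun m => all fun k => all fun c => all fun R => all fun s =>
    (isNat m ⊓ isSucc k m ⊓ isSat M k c R ⊓ isFun s m M) ⟹
    ball M fun x => bex M fun y => ball M fun z => z ∈ₛ y ⇔ (z ∈ₛ x ⊓ snocMem s m z R)

/-- `M` satisfies all instances of Replacement, for all codes `c` and parameters `s` in `M`:
if `c(s, u, v)` defines a partial function, then the image of every set `x` is a set `y`. -/
def satReplacement (M : Fin n) : Fml n :=
  all fun m => all fun k => all fun l => all fun c => all fun R => all fun s =>
    (isNat m ⊓ isSucc k m ⊓ isSucc l k ⊓ isSat M l c R ⊓ isFun s m M) ⟹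
    ball M fun x =>
      (ball x fun u => ball M fun v => ball M fun w =>
        (snocMem₂ s m u v R ⊓ snocMem₂ s m u w R) ⟹ v =ₛ w) ⟹
      bex M fun y => ball M fun v => v ∈ₛ y ⇔ bex x fun u => snocMem₂ s m u v R

/-- `M` is a transitive model of ZFC. -/
def isModelZFC (M : Fin n) : Fml n :=
  isTrans M ⊓
  relativize M (axExt ⊓ axPair ⊓ axUnion ⊓ axPower ⊓ axInfinity ⊓ axFoundation ⊓ axChoice) ⊓
  satSeparation M ⊓ satReplacement M

/-! ### The constructible universe -/

/-- `x` is a subset of `A` that is first-order definable over `(A, ∈)` with parameters in `A`. -/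
def isDefinable (x A : Fin n) : Fml n :=
  subset x A ⊓ ex fun m => ex fun k => ex fun c => ex fun R => ex fun s =>
    isNat m ⊓ isSucc k m ⊓ isSat A k c R ⊓ isFun s m A ⊓
    ball A fun a => a ∈ₛ x ⇔ snocMem s m a R

/-- `y = Def(A)` -/
def isDef (y A : Fin n) : Fml n := all fun x => x ∈ₛ y ⇔ isDefinable x A

/-- `f` is the sequence `(L_γ)` for `γ ∈ β`: `L_0 = ∅`, `L_{η+1} = Def(L_η)`, and
`L_γ = ⋃_{η ∈ γ} L_η` for limit `γ`. -/
def isLSeq (f β : Fin n) : Fml n :=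
  (ex fun b => isFun f β b) ⊓
  ball β fun γ => ex fun y => pairMem γ y f ⊓
    ((isEmpty γ ⊓ isEmpty y) ⊔
     (bex γ fun η => isSucc γ η ⊓ ex fun w => pairMem η w f ⊓ isDef y w) ⊔
     (∼(isZeroOrSucc γ) ⊓
        all fun z => z ∈ₛ y ⇔ bex γ fun η => ex fun w => pairMem η w f ⊓ z ∈ₛ w))

/-- `y = L_α` -/
def isL (y α : Fin n) : Fml n :=
  isOrd α ⊓ ex fun β => ex fun f => isSucc β α ⊓ isLSeq f β ⊓ pairMem α y f

/-- An instance of the separation schema: for all parameters `p` and all `x` there is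
`y = {z ∈ x | φ(p, z)}`. -/
def separation (φ : Fml (n + 1)) : setLang.Sentence :=
  FirstOrder.Language.BoundedFormula.alls (n := n) <|
    all fun x => ex fun y => all fun z =>
      z ∈ₛ y ⇔ (z ∈ₛ x ⊓ rename (Fin.snoc (fun i : Fin n => (i : Fin (n + 3))) z) φ)

/-! ### The theory LZFC and the further statements -/

/-- The Cartesian product of two sets is a set. -/
def axProduct : setLang.Sentence :=
  all fun a => all fun b => ex fun c => all fun p =>
    p ∈ₛ c ⇔ bex a fun x => bex b fun y => isPair p x y

/-- `ω` exists. -/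
def axOmega : setLang.Sentence := ex fun w => isOmega w

/-- `Loc(ZFC)`: every set belongs to a transitive model of ZFC. -/
def axLoc : setLang.Sentence := all fun x => ex fun y => x ∈ₛ y ⊓ isModelZFC y

/-- Basic set theory. -/
def BST : setLang.Theory :=
  {axEmpty, axExt, axPair, axUnion, axProduct, axOmega} ∪
  {σ | ∃ (n : ℕ) (φ : Fml (n + 1)), IsDelta0 φ ∧ σ = separation φ}

/-- Local ZFC. -/
def LZFC : setLang.Theory := BST ∪ {axLoc}

/-- `V = L` -/
def VeqL : setLang.Sentence := all fun x => ex fun α => ex fun y => isL y α ⊓ x ∈ₛ y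

/-- `GC`: there is a greatest cardinality, `∃ κ ∀ y |y| ≤ |κ|`, for an ordinal `κ`. -/
def GC : setLang.Sentence := ex fun κ => isOrd κ ⊓ all fun y => cardLE y κ

/-- Every set is countable: `∀ x |x| ≤ ω`. -/
def allCountable : setLang.Sentence :=
  all fun x => ex fun w => isOmega w ⊓ cardLE x w

/-- The Tall Model Axiom: `∀ κ ∃ α > κ ∀ δ ≥ α ∃ M (δ ∈ M ∧ M ⊨ |κ| < |α|)`,
for ordinals `κ, α, δ` and transitive models `M` of ZFC. -/
def TMA : setLang.Sentence :=
  all fun κ => isOrd κ ⟹ ex fun α => isOrd α ⊓ κ ∈ₛ α ⊓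
    all fun δ => (isOrd δ ⊓ (α ∈ₛ δ ⊔ α =ₛ δ)) ⟹
      ex fun M => isModelZFC M ⊓ δ ∈ₛ M ⊓ relativize M (cardLT κ α)

end Formulas

end LocalZFC

/-!
Fix a structure `V` satisfying local ZFC.

If there is a greatest cardinality `κ` and `V = L`, the Tall Model Axiom fails at `κ`: for every
ordinal `α` there is an injection `f : α → κ`, and `f ∈ L_β` for some `β`. A transitive model `M` of
ZFC that contains an ordinal `δ ≥ α, β` contains the sequence of the `L_γ`, `γ ≤ β`, because its
construction is absolute (`IsModel.lSeq_mem`). So `f ∈ M`, and `M` does not satisfy `|κ| < |α|`.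
This is `not_tallModels`. If every set is countable, `ω` is a greatest cardinality.

Conversely, suppose that there is no greatest cardinality, and let `κ` be an ordinal. Some set `y`
does not inject into `κ`. In a transitive model that contains `y`, the axiom of choice enumerates
`y` injectively along an ordinal `η` (`exists_enumeration`). Hence `η` does not inject into `κ`, in
`V` and all the more in any transitive model, so every transitive model containing `η` satisfies
`|κ| < |η|`. This is `tallModels_of_not_greatestCard`; it does not need `V = L`.

As `V` itself need satisfy neither Powerset nor Replacement nor full Separation, and Foundation is
not among its axioms, all constructions are carried out inside transitive models, which `Loc(ZFC)`
provides.

* A transitive class `D`, be it `V` or a transitive set, is treated as a substructure `D.Elts`. The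
  `realize_…` lemmas translate a formula evaluated in `D.Elts` into a predicate on `V` that does not
  mention `D`: this is absoluteness. A property that one formula expresses in all transitive classes
  is separable in `V`, since the relativization of a formula to a set is `Δ₀` (`Sep.of_formula`).
  Foundation in a model then yields `∈`-induction for such properties (`Sep.exists_min`,
  `Sep.induction`).
* `V` may be ill-founded and its natural numbers nonstandard. Therefore the schemas of Separation
  and Replacement in a model, which refer to codes inside `V`, have to be linked to actual formulas:
  each formula has a code with the right satisfaction relation (`codable_formula`), whence
  `IsModel.separation` and `IsModel.replacement`.
* A model contains the satisfaction sequences for its elements (`IsModel.satSeq_mem`), so that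
  satisfaction, definability and the hierarchy of the `L_γ` are absolute for it
  (`IsModel.defClosed`).
-/

set_option linter.unusedSectionVars false

namespace LocalZFC

/-! ### Semantics of the basic formulas -/

/-- A variable of a context is also a variable of every larger context. -/
local instance coeVarSucc {n : ℕ} : Coe (Fin n) (Fin (n + 1)) := ⟨Fin.castSucc⟩

/-- The interpretation of `∈ₛ` in a structure. -/
instance instMembershipStructure {W : Type*} [setLang.Structure W] : Membership W W :=
  ⟨fun y x => FirstOrder.Language.Structure.RelMap memRel ![x, y]⟩

section Realize

variable {W : Type*} [setLang.Structure W] {n : ℕ} {v : Empty → W} {xs : Fin n → W}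

@[simp] theorem realize_mem {x y : Fin n} : (x ∈ₛ y).Realize v xs ↔ xs x ∈ xs y := by
  unfold mem
  rw [FirstOrder.Language.BoundedFormula.realize_rel₂]
  simp [Membership.mem]

@[simp] theorem realize_eq {x y : Fin n} : (x =ₛ y).Realize v xs ↔ xs x = xs y := by
  unfold eq
  simp

@[simp] theorem realize_all {f : Fin (n + 1) → Fml (n + 1)} :
    (all f).Realize v xs ↔ ∀ a, (f (Fin.last n)).Realize v (Fin.snoc xs a) := by
  simp [all]

@[simp] theorem realize_ex {f : Fin (n + 1) → Fml (n + 1)} :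
    (ex f).Realize v xs ↔ ∃ a, (f (Fin.last n)).Realize v (Fin.snoc xs a) := by
  simp [ex]

theorem realize_ball_iff {x : Fin n} {f : Fin (n + 1) → Fml (n + 1)} :
    (ball x f).Realize v xs ↔
      ∀ a, a ∈ xs x → (f (Fin.last n)).Realize v (Fin.snoc xs a) := by
  simp [ball]

/-- Renaming variables composes the assignment with the renaming. -/
theorem realize_rename {m : ℕ} {φ : Fml m} {n : ℕ} (f : Fin m → Fin n) (xs : Fin n → W) :
    (rename f φ).Realize v xs ↔ φ.Realize v (xs ∘ f) := by
  have key : ∀ {m n : ℕ} (f : Fin m → Fin n) (xs : Fin n → W) (t : setLang.Term (Empty ⊕ Fin m)),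
      (t.relabel (Sum.map id f)).realize (Sum.elim v xs) = t.realize (Sum.elim v (xs ∘ f)) := by
    intro m n f xs t
    rw [FirstOrder.Language.Term.realize_relabel]
    congr 1
    funext i
    cases i <;> rfl
  induction φ generalizing n with
  | falsum => rfl
  | equal s t =>
    simp only [rename, FirstOrder.Language.BoundedFormula.Realize, key]
  | rel R ts =>
    simp only [rename, FirstOrder.Language.BoundedFormula.Realize, key]
  | imp φ ψ ih₁ ih₂ =>
    simp only [rename, FirstOrder.Language.BoundedFormula.Realize, ih₁ f xs, ih₂ f xs]
  | all φ ih =>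
    simp only [rename, FirstOrder.Language.BoundedFormula.Realize]
    refine forall_congr' fun a => ?_
    refine (ih _ _).trans ?_
    have : (Fin.snoc xs a : Fin _ → W) ∘ Fin.snoc (fun i => (f i).castSucc) (Fin.last n)
        = Fin.snoc (xs ∘ f) a := by
      funext i
      refine Fin.lastCases ?_ (fun j => ?_) i <;> simp
    rw [this]

end Realize

/-! ### Transitive classes -/

variable {V : Type*} [setLang.Structure V]

/-- A transitive class of a structure for the language of set theory: the whole structure, or the
elements of a transitive set. -/
structure TransClass (V : Type*) [setLang.Structure V] where
  carrier : V → Prop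
  down : ∀ {x y}, carrier y → x ∈ y → carrier x

/-- The elements of a transitive class, as a substructure. -/
@[ext] structure TransClass.Elts (D : TransClass V) where
  val : V
  prop : D.carrier val

instance {D : TransClass V} : setLang.Structure D.Elts where
  funMap f := nomatch f
  RelMap r xs := FirstOrder.Language.Structure.RelMap r fun i => (xs i).val

@[simp] theorem elts_mem {D : TransClass V} {a b : D.Elts} : a ∈ b ↔ a.val ∈ b.val := by
  change FirstOrder.Language.Structure.RelMap memRel (fun i => (![a, b] i).val) ↔
    FirstOrder.Language.Structure.RelMap memRel ![a.val, b.val]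
  have : (fun i => (![a, b] i).val) = ![a.val, b.val] := by
    funext i; fin_cases i <;> rfl
  rw [this]

theorem elts_eq {D : TransClass V} {a b : D.Elts} : a = b ↔ a.val = b.val :=
  TransClass.Elts.ext_iff

/-- `x` is a transitive set. -/
def Tr (x : V) : Prop := ∀ y ∈ x, ∀ z ∈ y, z ∈ x

/-- The class of all sets. -/
def TransClass.univ (V : Type*) [setLang.Structure V] : TransClass V :=
  ⟨fun _ => True, fun _ _ => trivial⟩

/-- The class of the elements of a transitive set. -/
def TransClass.ofSet (A : V) (hA : Tr A) : TransClass V :=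
  ⟨fun x => x ∈ A, fun hy hx => hA _ hy _ hx⟩

/-- Every set, as an element of the class of all sets. -/
def toUniv (x : V) : (TransClass.univ V).Elts := ⟨x, trivial⟩

@[simp] theorem toUniv_val (x : V) : (toUniv x).val = x := rfl

/-- `V` is isomorphic to the class of all sets, so results on transitive classes apply to it. -/
theorem realize_univ {n : ℕ} (φ : Fml n) (v : Empty → V) (xs : Fin n → V) :
    φ.Realize v xs ↔ φ.Realize Empty.elim (fun i => toUniv (xs i)) := by
  let e : FirstOrder.Language.Equiv setLang V (TransClass.univ V).Elts :=
    { toFun := toUniv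
      invFun := fun a => a.val
      left_inv := fun _ => rfl
      right_inv := fun _ => rfl
      map_fun' := fun f => nomatch f
      map_rel' := fun _ _ => Iff.rfl }
  rw [← FirstOrder.Language.StrongHomClass.realize_boundedFormula e φ]
  have : (e ∘ v) = Empty.elim := by funext i; exact i.elim
  rw [this]
  rfl

section Relativize

variable {n : ℕ} {v : Empty → V}

@[simp] theorem relativize_all {A : Fin n} {φ : Fml (n + 1)} :
    relativize A φ.all = ball A fun _ => relativize A.castSucc φ := rfl

/-- Relativization to a transitive set `A` means truth in the substructure of its elements. -/
theorem realize_relativize_rename {m : ℕ} (φ : Fml m) {n : ℕ} (f : Fin m → Fin n) (A : Fin n)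
    (xs : Fin n → V) (hA : Tr (xs A)) (ys : Fin m → (TransClass.ofSet (xs A) hA).Elts)
    (h : ∀ i, (ys i).val = xs (f i)) :
    (relativize A (rename f φ)).Realize v xs ↔ φ.Realize Empty.elim ys := by
  obtain ⟨B, hB⟩ : ∃ B, B = xs A := ⟨_, rfl⟩
  revert ys
  revert hA
  rw [← hB]
  intro hA ys h
  have key : ∀ {m n : ℕ} (f : Fin m → Fin n) (xs : Fin n → V)
      (ys : Fin m → (TransClass.ofSet B hA).Elts) (_ : ∀ i, (ys i).val = xs (f i))
      (t : setLang.Term (Empty ⊕ Fin m)),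
      (t.relabel (Sum.map id f)).realize (Sum.elim v xs) =
        (t.realize (Sum.elim Empty.elim ys)).val := by
    intro m n f xs ys h t
    match t with
    | .var (.inl e) => exact e.elim
    | .var (.inr i) => simp [h]
    | .func g _ => exact nomatch g
  induction φ generalizing n with
  | falsum => rfl
  | equal s t =>
    simp only [rename, relativize, FirstOrder.Language.BoundedFormula.Realize, key f xs ys h,
      elts_eq]
  | rel R ts =>
    simp only [rename, relativize, FirstOrder.Language.BoundedFormula.Realize, key f xs ys h]
    rfl
  | imp φ ψ ih₁ ih₂ =>
    simp only [rename, relativize, FirstOrder.Language.BoundedFormula.Realize,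
      ih₁ f A xs hB ys h, ih₂ f A xs hB ys h]
  | all φ ih =>
    simp only [rename, relativize_all, realize_ball_iff]
    simp only [FirstOrder.Language.BoundedFormula.Realize]
    have := fun a : (TransClass.ofSet B hA).Elts =>
      ih (Fin.snoc (fun i => (f i).castSucc) (Fin.last n)) A.castSucc (Fin.snoc xs a.val)
        (by simpa using hB) (Fin.snoc ys a) (by
          intro i
          refine Fin.lastCases ?_ (fun j => ?_) i
          · simp
          · simp [h])
    constructor
    · intro H a
      exact (this a).1 (H a.val (hB ▸ a.prop))
    · intro H a ha
      rw [← hB] at ha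
      exact (this ⟨a, ha⟩).2 (H _)

/-- The language has no function symbols and no free variables besides the indexed ones. -/
theorem exists_term_eq_var {n : ℕ} (t : setLang.Term (Empty ⊕ Fin n)) : ∃ i, t = .var (.inr i) := by
  match t with
  | .var (.inl e) => exact e.elim
  | .var (.inr i) => exact ⟨i, rfl⟩
  | .func g _ => exact nomatch g

theorem IsDelta0.relativize {n : ℕ} (φ : Fml n) (A : Fin n) : IsDelta0 (relativize A φ) := by
  induction φ with
  | falsum => exact .falsum
  | equal s t =>
    obtain ⟨i, rfl⟩ := exists_term_eq_var s
    obtain ⟨j, rfl⟩ := exists_term_eq_var t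
    exact .eq i j
  | rel R ts =>
    cases R
    obtain ⟨i, hi⟩ := exists_term_eq_var (ts 0)
    obtain ⟨j, hj⟩ := exists_term_eq_var (ts 1)
    have : ts = ![.var (.inr i), .var (.inr j)] := by
      funext k; fin_cases k <;> assumption
    subst this
    exact .mem i j
  | imp φ ψ ih₁ ih₂ => exact .imp (ih₁ _) (ih₂ _)
  | all φ ih => exact .ball _ (ih _)

end Relativize

/-! ### Basic set theory in a model of local ZFC -/

/-- The single axioms of ZFC, conjoined as in `isModelZFC`. -/
def finAx : Fml 0 :=
  axExt ⊓ axPair ⊓ axUnion ⊓ axPower ⊓ axInfinity ⊓ axFoundation ⊓ axChoice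

section Rename

variable {m k : ℕ} (f : Fin m → Fin k)

theorem rename_all (φ : Fml (m + 1)) :
    rename f (∀' φ) = ∀' (rename (Fin.snoc (fun i => (f i).castSucc) (Fin.last k)) φ) := rfl

theorem rename_ex (φ : Fml (m + 1)) :
    rename f (∃' φ) = ∃' (rename (Fin.snoc (fun i => (f i).castSucc) (Fin.last k)) φ) := rfl

theorem rename_imp (φ ψ : Fml m) : rename f (φ ⟹ ψ) = (rename f φ ⟹ rename f ψ) := rfl

theorem rename_not (φ : Fml m) : rename f (∼φ) = ∼(rename f φ) := rfl

theorem rename_bot : rename f (⊥ : Fml m) = ⊥ := rfl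

theorem rename_inf (φ ψ : Fml m) : rename f (φ ⊓ ψ) = (rename f φ ⊓ rename f ψ) := rfl

theorem rename_sup (φ ψ : Fml m) : rename f (φ ⊔ ψ) = (rename f φ ⊔ rename f ψ) := rfl

theorem rename_iff (φ ψ : Fml m) : rename f (φ ⇔ ψ) = (rename f φ ⇔ rename f ψ) := rfl

theorem rename_mem (x y : Fin m) : rename f (x ∈ₛ y) = (f x ∈ₛ f y) := by
  unfold mem FirstOrder.Language.Relations.boundedFormula₂
    FirstOrder.Language.Relations.boundedFormula
  simp only [rename]
  congr 1
  funext i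
  fin_cases i <;> rfl

theorem rename_eq (x y : Fin m) : rename f (x =ₛ y) = (f x =ₛ f y) := rfl

theorem rename_cardLT (a b : Fin m) : rename f (cardLT a b) = cardLT (f a) (f b) := by
  simp only [cardLT, cardLE, isInj, isFun, pairMem, isPair, isUPair, bex, ball, ex, all, rename_all,
    rename_ex, rename_imp, rename_not, rename_inf, rename_sup, rename_mem, rename_eq,
    Fin.snoc_castSucc, Fin.snoc_last]

end Rename

theorem rename_finAx {n : ℕ} : rename (Fin.elim0 : Fin 0 → Fin n) finAx =
    (axExt ⊓ axPair ⊓ axUnion ⊓ axPower ⊓ axInfinity ⊓ axFoundation ⊓ axChoice : Fml n) := by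
  simp only [finAx, axExt, axPair, axUnion, axPower, axInfinity, axFoundation, axChoice, all, ex,
    ball, isEmpty, isSucc, isUPair, subset, rename_all, rename_imp, rename_not, rename_inf,
    rename_sup, rename_mem, rename_eq, rename_ex, rename_iff, rename_bot, Fin.snoc_castSucc,
    Fin.snoc_last]

/-- `A` is a transitive set that satisfies the single axioms of ZFC (all but the two schemas). -/
def PreModel (A : V) : Prop :=
  ∃ hA : Tr A, finAx.Realize Empty.elim (Fin.elim0 : Fin 0 → (TransClass.ofSet A hA).Elts)

theorem realize_relativize_finAx {n : ℕ} {v : Empty → V} (A : Fin n) (xs : Fin n → V)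
    (hA : Tr (xs A)) :
    (relativize A (axExt ⊓ axPair ⊓ axUnion ⊓ axPower ⊓ axInfinity ⊓ axFoundation ⊓ axChoice :
      Fml n)).Realize v xs ↔ PreModel (xs A) := by
  rw [← rename_finAx]
  refine (realize_relativize_rename _ _ _ _ hA Fin.elim0 (fun i => i.elim0)).trans ?_
  exact ⟨fun h => ⟨hA, h⟩, fun ⟨_, h⟩ => h⟩

theorem realize_isTrans_iff {n : ℕ} {v : Empty → V} (A : Fin n) (xs : Fin n → V) :
    (isTrans A).Realize v xs ↔ Tr (xs A) := by
  simp [isTrans, subset, realize_ball_iff, Tr]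

variable [hV : V ⊨ LZFC]

theorem realize_axiom {σ : setLang.Sentence} (h : σ ∈ LZFC) :
    FirstOrder.Language.BoundedFormula.Realize σ Empty.elim (Fin.elim0 : Fin 0 → V) := by
  have := hV.realize_of_mem σ h
  unfold FirstOrder.Language.Sentence.Realize FirstOrder.Language.Formula.Realize at this
  convert this using 1

theorem set_ext {x y : V} (h : ∀ z, z ∈ x ↔ z ∈ y) : x = y := by
  have := realize_axiom (V := V) (σ := axExt) (by simp [LZFC, BST])
  simp [axExt] at this
  exact this x y h

theorem exists_empty : ∃ x : V, ∀ y, y ∉ x := by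
  have := realize_axiom (V := V) (σ := axEmpty) (by simp [LZFC, BST])
  simp only [axEmpty, isEmpty, realize_ball_iff, realize_ex] at this
  exact this

theorem exists_upair (x y : V) : ∃ p : V, ∀ z, z ∈ p ↔ z = x ∨ z = y := by
  have := realize_axiom (V := V) (σ := axPair) (by simp [LZFC, BST])
  simp [axPair, isUPair, realize_ball_iff] at this
  obtain ⟨p, ⟨h1, h2⟩, h3⟩ := this x y
  exact ⟨p, fun z => ⟨h3 z, by rintro (rfl | rfl) <;> assumption⟩⟩

theorem exists_sUnion (x : V) : ∃ u : V, ∀ z, z ∈ u ↔ ∃ y, y ∈ x ∧ z ∈ y := by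
  have := realize_axiom (V := V) (σ := axUnion) (by simp [LZFC, BST])
  simp [axUnion] at this
  exact this x

/-- `Δ₀`-Separation. -/
theorem separation_delta0 {n : ℕ} {φ : Fml (n + 1)} (hφ : IsDelta0 φ) (p : Fin n → V) (x : V) :
    ∃ y : V, ∀ z, z ∈ y ↔ z ∈ x ∧ φ.Realize Empty.elim (Fin.snoc p z : Fin (n + 1) → V) := by
  have := realize_axiom (V := V) (σ := separation φ) (by
    refine Or.inl (Or.inr ⟨n, φ, hφ, rfl⟩))
  unfold separation at this
  have h2 := (FirstOrder.Language.BoundedFormula.realize_alls.1 this) p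
  simp at h2
  obtain ⟨y, hy⟩ := h2 x
  refine ⟨y, fun z => (hy z).trans (and_congr_right fun _ => ?_)⟩
  refine (realize_rename _ _).trans ?_
  have : (Fin.snoc (Fin.snoc (Fin.snoc p x : Fin (n + 1) → V) y : Fin (n + 2) → V) z :
      Fin (n + 3) → V) ∘ Fin.snoc (fun i : Fin n => i.castSucc.castSucc.castSucc) (Fin.last (n + 2))
      = (Fin.snoc p z : Fin (n + 1) → V) := by
    funext i
    refine Fin.lastCases ?_ (fun j => ?_) i <;> simp
  rw [← this]

/-- Separation for formulas relativized to a transitive set. -/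
theorem separation_relativized {A : V} (hA : Tr A) {n : ℕ} (φ : Fml (n + 1))
    (p : Fin n → (TransClass.ofSet A hA).Elts) {x : V} (hx : ∀ z ∈ x, z ∈ A) :
    ∃ y : V, ∀ z, z ∈ y ↔ ∃ h : z ∈ x,
      φ.Realize Empty.elim (Matrix.vecCons ⟨z, hx z h⟩ p) := by
  obtain ⟨y, hy⟩ := separation_delta0 (n := n + 1)
    (IsDelta0.relativize (rename (n := n + 1) (m := n + 2)
      (Fin.cons (Fin.last (n + 1)) fun i => i.succ.castSucc) φ) (0 : Fin (n + 1)).castSucc)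
    (Fin.cons A fun i => (p i).val) x
  refine ⟨y, fun z => (hy z).trans ⟨fun ⟨h, h'⟩ => ⟨h, ?_⟩, fun ⟨h, h'⟩ => ⟨h, ?_⟩⟩⟩ <;>
  · revert h'
    refine Iff.mp ?_
    set xs : Fin (n + 2) → V := Fin.snoc (Fin.cons A fun i => (p i).val : Fin (n + 1) → V) z
    have h0 : xs (0 : Fin (n + 1)).castSucc = A := by
      simp only [xs, Fin.snoc_castSucc]
      rfl
    have key : ∀ (B : V) (hB : Tr B) (e : xs (0 : Fin (n + 1)).castSucc = B)
        (ys : Fin (n + 1) → (TransClass.ofSet B hB).Elts)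
        (_ : ∀ i, (ys i).val = xs ((Fin.cons (Fin.last (n + 1)) fun i => i.succ.castSucc :
          Fin (n + 1) → Fin (n + 2)) i)),
        (relativize (0 : Fin (n + 1)).castSucc (rename (n := n + 1) (m := n + 2)
      (Fin.cons (Fin.last (n + 1)) fun i => i.succ.castSucc) φ)).Realize Empty.elim xs ↔
        φ.Realize Empty.elim ys := by
      intro B hB e ys
      subst e
      exact fun h => realize_relativize_rename _ _ _ _ hB _ h
    have := key A hA h0 (Matrix.vecCons ⟨z, hx z h⟩ p) (by
      intro i
      refine Fin.cases ?_ (fun j => ?_) i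
      · simp [xs]
      · simp only [Matrix.cons_val_succ, Fin.cons_succ, xs]
        rw [Fin.snoc_castSucc, Fin.cons_succ])
    first | exact this | exact this.symm

/-- `Loc(ZFC)`, for the single axioms. This form is used first, as reading off the schemas requires
the notions of satisfaction. -/
theorem exists_preModel (x : V) : ∃ A : V, x ∈ A ∧ PreModel A := by
  have := realize_axiom (V := V) (σ := axLoc) (by simp [LZFC])
  simp only [axLoc, realize_all, realize_ex, FirstOrder.Language.BoundedFormula.realize_inf,
    realize_mem, isModelZFC] at this
  obtain ⟨A, h1, ⟨⟨h2, h3⟩, -⟩, -⟩ := this x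
  rw [realize_isTrans_iff] at h2
  rw [realize_relativize_finAx _ _ h2] at h3
  exact ⟨A, h1, h3⟩

/-! ### Set operations and absoluteness of bounded notions -/

noncomputable section Operations

/-- The empty set. -/
def emp (V : Type*) [setLang.Structure V] [V ⊨ LZFC] : V := Classical.choose exists_empty

/-- The unordered pair. -/
def upair (x y : V) : V := Classical.choose (exists_upair x y)

/-- The union of the elements of a set. -/
def sUn (x : V) : V := Classical.choose (exists_sUnion x)

/-- The union of two sets. -/
def un (x y : V) : V := sUn (upair x y)

/-- The successor `x ∪ {x}`. -/
def suc (x : V) : V := un x (upair x x)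

/-- The Kuratowski pair. -/
def opair (x y : V) : V := upair (upair x x) (upair x y)

/-- The extension `s ∪ {(m, a)}`. -/
def app (s m a : V) : V := un s (upair (opair m a) (opair m a))

@[simp] theorem not_mem_emp (x : V) : x ∉ emp V := Classical.choose_spec (exists_empty (V := V)) x
@[simp] theorem mem_upair {x y z : V} : z ∈ upair x y ↔ z = x ∨ z = y :=
  Classical.choose_spec (exists_upair x y) z
theorem mem_sUn {x z : V} : z ∈ sUn x ↔ ∃ y, y ∈ x ∧ z ∈ y :=
  Classical.choose_spec (exists_sUnion x) z
@[simp] theorem mem_un {x y z : V} : z ∈ un x y ↔ z ∈ x ∨ z ∈ y := by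
  simp [un, mem_sUn]
@[simp] theorem mem_suc {x z : V} : z ∈ suc x ↔ z ∈ x ∨ z = x := by
  simp [suc]
@[simp] theorem mem_app {s m a z : V} : z ∈ app s m a ↔ z ∈ s ∨ z = opair m a := by
  simp [app]

theorem eq_emp_iff {x : V} : x = emp V ↔ ∀ y, y ∉ x :=
  ⟨fun h => h ▸ not_mem_emp, fun h => set_ext fun z =>
    ⟨fun hz => (h z hz).elim, fun hz => (not_mem_emp z hz).elim⟩⟩

theorem eq_upair_iff {p x y : V} : p = upair x y ↔ x ∈ p ∧ y ∈ p ∧ ∀ z ∈ p, z = x ∨ z = y := by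
  constructor
  · rintro rfl
    simp
  · rintro ⟨h1, h2, h3⟩
    refine set_ext fun z => ⟨fun h => mem_upair.2 (h3 z h), fun h => ?_⟩
    rcases mem_upair.1 h with rfl | rfl <;> assumption

theorem upair_eq_upair_self {x y z : V} (h : upair x y = upair z z) : x = z ∧ y = z := by
  have h1 : x ∈ upair z z := h ▸ (by simp)
  have h2 : y ∈ upair z z := h ▸ (by simp)
  simp at h1 h2
  exact ⟨h1, h2⟩

theorem upair_left_cancel {x y z : V} (h : upair x y = upair x z) : y = z := by
  have h1 : y ∈ upair x z := h ▸ (by simp)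
  have h2 : z ∈ upair x y := h ▸ (by simp)
  simp at h1 h2
  grind

@[simp] theorem opair_inj {a b c d : V} : opair a b = opair c d ↔ a = c ∧ b = d := by
  refine ⟨fun h => ?_, fun ⟨h1, h2⟩ => by rw [h1, h2]⟩
  have h1 : upair a a ∈ opair c d := h ▸ (by simp [opair])
  have hac : a = c := by
    rcases mem_upair.1 h1 with h1 | h1
    · exact (upair_eq_upair_self h1).1
    · exact (upair_eq_upair_self h1.symm).1.symm
  subst hac
  exact ⟨rfl, upair_left_cancel (upair_left_cancel h)⟩

end Operations

theorem TransClass.of_upair (D : TransClass V) {a b : V} (h : D.carrier (upair a b)) :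
    D.carrier a ∧ D.carrier b := ⟨D.down h (by simp), D.down h (by simp)⟩

theorem TransClass.of_opair (D : TransClass V) {a b : V} (h : D.carrier (opair a b)) :
    D.carrier a ∧ D.carrier b := D.of_upair (D.of_upair h).2

theorem TransClass.of_opair_mem (D : TransClass V) {a b f : V} (hf : D.carrier f)
    (h : opair a b ∈ f) : D.carrier a ∧ D.carrier b := D.of_opair (D.down hf h)

/-- `x` is an ordinal. -/
def IsOrd (x : V) : Prop := Tr x ∧ ∀ y ∈ x, ∀ z ∈ x, y ∈ z ∨ y = z ∨ z ∈ y

/-- `x` is `∅` or a successor. -/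
def ZeroOrSuc (x : V) : Prop := x = emp V ∨ ∃ y ∈ x, x = suc y

/-- `x` is a natural number. -/
def IsNat (x : V) : Prop := IsOrd x ∧ ZeroOrSuc x ∧ ∀ y ∈ x, ZeroOrSuc y

/-- `f` is a function from `a` to `b`. -/
def IsFun (f a b : V) : Prop :=
  (∀ p ∈ f, ∃ x ∈ a, ∃ y ∈ b, p = opair x y) ∧ (∀ x ∈ a, ∃ y ∈ b, opair x y ∈ f) ∧
    ∀ x ∈ a, ∀ y ∈ b, ∀ z ∈ b, opair x y ∈ f → opair x z ∈ f → y = z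

/-- `f` is an injection from `a` to `b`. -/
def IsInj (f a b : V) : Prop :=
  IsFun f a b ∧ ∀ x ∈ a, ∀ y ∈ a, ∀ z ∈ b, opair x z ∈ f → opair y z ∈ f → x = y

section Realize

variable {D : TransClass V} {n : ℕ} {v : Empty → D.Elts} {xs : Fin n → D.Elts}

@[simp] theorem realize_ball {x : Fin n} {f : Fin (n + 1) → Fml (n + 1)} :
    (ball x f).Realize v xs ↔ ∀ a, ∀ h : a ∈ (xs x).val,
      (f (Fin.last n)).Realize v (Fin.snoc xs ⟨a, D.down (xs x).prop h⟩) := by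
  rw [realize_ball_iff]
  exact ⟨fun H a h => H ⟨a, D.down (xs x).prop h⟩ (elts_mem.2 h),
    fun H a h => H a.val (elts_mem.1 h)⟩

@[simp] theorem realize_bex {x : Fin n} {f : Fin (n + 1) → Fml (n + 1)} :
    (bex x f).Realize v xs ↔ ∃ a, ∃ h : a ∈ (xs x).val,
      (f (Fin.last n)).Realize v (Fin.snoc xs ⟨a, D.down (xs x).prop h⟩) := by
  simp [bex]

@[simp] theorem realize_subset {x y : Fin n} :
    (subset x y).Realize v xs ↔ ∀ z ∈ (xs x).val, z ∈ (xs y).val := by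
  simp [subset]

@[simp] theorem realize_isEmpty {x : Fin n} :
    (isEmpty x).Realize v xs ↔ (xs x).val = emp V := by
  simp [isEmpty, eq_emp_iff]

@[simp] theorem realize_isSucc {x y : Fin n} :
    (isSucc y x).Realize v xs ↔ (xs y).val = suc (xs x).val := by
  simp only [isSucc, FirstOrder.Language.BoundedFormula.realize_inf, realize_mem, realize_subset,
    realize_ball, FirstOrder.Language.BoundedFormula.realize_sup, realize_eq, elts_mem, elts_eq,
    Fin.snoc_last, Fin.snoc_castSucc]
  constructor
  · rintro ⟨⟨h1, h2⟩, h3⟩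
    refine set_ext fun z => ⟨fun h => mem_suc.2 (h3 z h), fun h => ?_⟩
    rcases mem_suc.1 h with h | rfl
    exacts [h2 z h, h1]
  · intro h
    rw [h]
    simp +contextual

@[simp] theorem realize_isUPair {p x y : Fin n} :
    (isUPair p x y).Realize v xs ↔ (xs p).val = upair (xs x).val (xs y).val := by
  simp [isUPair, eq_upair_iff, elts_eq, and_assoc]

@[simp] theorem realize_isPair {p x y : Fin n} :
    (isPair p x y).Realize v xs ↔ (xs p).val = opair (xs x).val (xs y).val := by
  simp [isPair]
  change _ ∧ _ ∧ (xs p).val = opair _ _ ↔ _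
  refine ⟨fun h => h.2.2, fun h => ⟨?_, ?_, h⟩⟩ <;> simp [h, opair]

@[simp] theorem realize_pairMem {f x y : Fin n} :
    (pairMem x y f).Realize v xs ↔ opair (xs x).val (xs y).val ∈ (xs f).val := by
  simp [pairMem]

@[simp] theorem realize_isTrans {x : Fin n} :
    (isTrans x).Realize v xs ↔ Tr (xs x).val := by
  simp [isTrans, Tr]

@[simp] theorem realize_isOrd {x : Fin n} :
    (isOrd x).Realize v xs ↔ IsOrd (xs x).val := by
  simp [isOrd, IsOrd, elts_eq, or_assoc]

@[simp] theorem realize_isZeroOrSucc {x : Fin n} :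
    (isZeroOrSucc x).Realize v xs ↔ ZeroOrSuc (xs x).val := by
  simp [isZeroOrSucc, ZeroOrSuc]

@[simp] theorem realize_isNat {x : Fin n} :
    (isNat x).Realize v xs ↔ IsNat (xs x).val := by
  simp [isNat, IsNat, and_assoc]

@[simp] theorem realize_isFun {f a b : Fin n} :
    (isFun f a b).Realize v xs ↔ IsFun (xs f).val (xs a).val (xs b).val := by
  simp [isFun, IsFun, elts_eq, and_assoc]

@[simp] theorem realize_isInj {f a b : Fin n} :
    (isInj f a b).Realize v xs ↔ IsInj (xs f).val (xs a).val (xs b).val := by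
  simp [isInj, IsInj, elts_eq]

@[simp] theorem realize_isOne {x : Fin n} :
    (isOne x).Realize v xs ↔ (xs x).val = suc (emp V) := by
  simp [isOne]
  grind [mem_suc]

@[simp] theorem realize_isTwo {x : Fin n} :
    (isTwo x).Realize v xs ↔ (xs x).val = suc (suc (emp V)) := by
  simp [isTwo]
  grind [mem_suc]

@[simp] theorem realize_isThree {x : Fin n} :
    (isThree x).Realize v xs ↔ (xs x).val = suc (suc (suc (emp V))) := by
  simp [isThree]
  grind [mem_suc]

@[simp] theorem realize_isFour {x : Fin n} :
    (isFour x).Realize v xs ↔ (xs x).val = suc (suc (suc (suc (emp V)))) := by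
  simp [isFour]
  grind [mem_suc]

end Realize

noncomputable section Codes

/-- The code of `xᵢ ∈ xⱼ`. -/
def cMem (i j : V) : V := opair (emp V) (opair i j)
/-- The code of `xᵢ = xⱼ`. -/
def cEq (i j : V) : V := opair (suc (emp V)) (opair i j)
/-- The code of a negation. -/
def cNot (d : V) : V := opair (suc (suc (emp V))) d
/-- The code of a conjunction. -/
def cAnd (d e : V) : V := opair (suc (suc (suc (emp V)))) (opair d e)
/-- The code of an existential formula. -/
def cEx (d : V) : V := opair (suc (suc (suc (suc (emp V))))) d
/-- A triple with its index, as it occurs in a satisfaction sequence. -/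
def ent (i m c R : V) : V := opair i (opair m (opair c R))

end Codes

section RealizeCodes

variable {D : TransClass V} {n : ℕ} {v : Empty → D.Elts} {xs : Fin n → D.Elts}

@[simp] theorem realize_codeMem {c i j : Fin n} :
    (codeMem c i j).Realize v xs ↔ (xs c).val = cMem (xs i).val (xs j).val := by
  simp [codeMem, cMem]
  constructor
  · rintro ⟨t, q, ⟨h1, h2⟩, h3⟩
    rw [h3, h1, h2]
  · intro h
    have := D.of_opair (h ▸ (xs c).prop)
    exact ⟨⟨_, this.1⟩, ⟨_, this.2⟩, ⟨rfl, rfl⟩, h⟩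

@[simp] theorem realize_codeEq {c i j : Fin n} :
    (codeEq c i j).Realize v xs ↔ (xs c).val = cEq (xs i).val (xs j).val := by
  simp [codeEq, cEq]
  constructor
  · rintro ⟨t, q, ⟨h1, h2⟩, h3⟩
    rw [h3, h1, h2]
  · intro h
    have := D.of_opair (h ▸ (xs c).prop)
    exact ⟨⟨_, this.1⟩, ⟨_, this.2⟩, ⟨rfl, rfl⟩, h⟩

@[simp] theorem realize_codeNot {c d : Fin n} :
    (codeNot c d).Realize v xs ↔ (xs c).val = cNot (xs d).val := by
  simp [codeNot, cNot]
  constructor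
  · rintro ⟨t, h1, h3⟩
    rw [h3, h1]
  · intro h
    have := D.of_opair (h ▸ (xs c).prop)
    exact ⟨⟨_, this.1⟩, rfl, h⟩

@[simp] theorem realize_codeAnd {c i j : Fin n} :
    (codeAnd c i j).Realize v xs ↔ (xs c).val = cAnd (xs i).val (xs j).val := by
  simp [codeAnd, cAnd]
  constructor
  · rintro ⟨t, q, ⟨h1, h2⟩, h3⟩
    rw [h3, h1, h2]
  · intro h
    have := D.of_opair (h ▸ (xs c).prop)
    exact ⟨⟨_, this.1⟩, ⟨_, this.2⟩, ⟨rfl, rfl⟩, h⟩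

@[simp] theorem realize_codeEx {c d : Fin n} :
    (codeEx c d).Realize v xs ↔ (xs c).val = cEx (xs d).val := by
  simp [codeEx, cEx]
  constructor
  · rintro ⟨t, h1, h3⟩
    rw [h3, h1]
  · intro h
    have := D.of_opair (h ▸ (xs c).prop)
    exact ⟨⟨_, this.1⟩, rfl, h⟩

@[simp] theorem realize_isSnoc {t s m a : Fin n} :
    (isSnoc t s m a).Realize v xs ↔ (xs t).val = app (xs s).val (xs m).val (xs a).val := by
  simp [isSnoc]
  constructor
  · rintro ⟨⟨h1, h2⟩, h3⟩
    refine set_ext fun z => ⟨fun h => mem_app.2 (h3 z h), fun h => ?_⟩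
    rcases mem_app.1 h with h | rfl
    exacts [h1 z h, h2]
  · intro h
    rw [h]
    simp +contextual

@[simp] theorem realize_snocMem {s m a R : Fin n} :
    (snocMem s m a R).Realize v xs ↔
      app (xs s).val (xs m).val (xs a).val ∈ (xs R).val := by
  simp [snocMem]

@[simp] theorem realize_entry {d i m c R : Fin n} :
    (entry d i m c R).Realize v xs ↔
      ent (xs i).val (xs m).val (xs c).val (xs R).val ∈ (xs d).val := by
  simp [entry, ent]
  constructor
  · rintro ⟨q, e, ⟨h1, h2⟩, h3⟩
    rwa [h2, h1] at h3
  · intro h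
    have h1 := (D.of_opair_mem (xs d).prop h).2
    exact ⟨⟨_, (D.of_opair h1).2⟩, ⟨_, h1⟩, ⟨rfl, rfl⟩, h⟩

@[simp] theorem realize_isRel {R m A : Fin n} {X : Fin (n + 1) → Fml (n + 1)} :
    (isRel R m A X).Realize v xs ↔ ∀ s : D.Elts, s.val ∈ (xs R).val ↔
      IsFun s.val (xs m).val (xs A).val ∧ (X (Fin.last n)).Realize v (Fin.snoc xs s) := by
  simp [isRel]

end RealizeCodes

/-! ### Closure of transitive models under the single axioms -/

section PreModel

variable {A : V}

theorem PreModel.tr (hA : PreModel A) : Tr A := hA.1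

/-- The class of the elements of a model. -/
def PreModel.cls (hA : PreModel A) : TransClass V := TransClass.ofSet A hA.tr

theorem PreModel.emp_mem (hA : PreModel A) : emp V ∈ A := by
  obtain ⟨hT, h⟩ := hA
  simp [finAx, axInfinity] at h
  obtain ⟨w, ⟨e, h1, h2⟩, -⟩ := h.1.1.2
  exact h1 ▸ e.prop

theorem PreModel.upair_mem (hA : PreModel A) {x y : V} (hx : x ∈ A) (hy : y ∈ A) :
    upair x y ∈ A := by
  obtain ⟨hT, h⟩ := hA
  simp [finAx, axPair] at h
  obtain ⟨p, hp⟩ := h.1.1.1.1.1.2 ⟨x, hx⟩ ⟨y, hy⟩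
  have : p.val = upair x y := hp
  exact this ▸ p.prop

theorem PreModel.sUn_mem (hA : PreModel A) {x : V} (hx : x ∈ A) : sUn x ∈ A := by
  obtain ⟨hT, h⟩ := hA
  simp [finAx, axUnion] at h
  obtain ⟨p, hp⟩ := h.1.1.1.1.2 ⟨x, hx⟩
  have : p.val = sUn x := by
    refine set_ext fun z => ?_
    rw [mem_sUn]
    constructor
    · intro hz
      obtain ⟨y, h1, h2⟩ := (hp ⟨z, hT _ p.prop _ hz⟩).1 hz
      exact ⟨y.val, h1, h2⟩
    · rintro ⟨y, h1, h2⟩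
      have hy := hT _ hx _ h1
      exact (hp ⟨z, hT _ hy _ h2⟩).2 ⟨⟨y, hy⟩, h1, h2⟩
  exact this ▸ p.prop

/-- The power set as computed in a model. -/
theorem PreModel.exists_power (hA : PreModel A) {x : V} (hx : x ∈ A) :
    ∃ p ∈ A, ∀ z, z ∈ p ↔ z ∈ A ∧ ∀ w ∈ z, w ∈ x := by
  obtain ⟨hT, h⟩ := hA
  simp [finAx, axPower] at h
  obtain ⟨p, hp⟩ := h.1.1.1.2 ⟨x, hx⟩
  refine ⟨p.val, p.prop, fun z => ⟨fun hz => ?_, fun hz => ?_⟩⟩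
  · have hzA := hT _ p.prop _ hz
    exact ⟨hzA, (hp ⟨z, hzA⟩).1 hz⟩
  · exact (hp ⟨z, hz.1⟩).2 hz.2

theorem PreModel.foundation (hA : PreModel A) {x : V} (hx : x ∈ A) (hne : x ≠ emp V) :
    ∃ y ∈ x, ∀ z ∈ y, z ∉ x := by
  obtain ⟨hT, h⟩ := hA
  simp [finAx, axFoundation] at h
  obtain ⟨y, h1, h2⟩ := h.1.2 ⟨x, hx⟩ hne
  exact ⟨y.val, h1, fun z hz => h2 ⟨z, hT _ y.prop _ hz⟩ hz⟩

theorem PreModel.choice (hA : PreModel A) {x : V} (hx : x ∈ A) (hne : ∀ y ∈ x, y ≠ emp V)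
    (hdisj : ∀ y ∈ x, ∀ z ∈ x, ∀ u ∈ y, u ∈ z → y = z) :
    ∃ c ∈ A, ∀ y ∈ x, ∃ u, u ∈ y ∧ u ∈ c ∧ ∀ v, v ∈ y → v ∈ c → v = u := by
  obtain ⟨hT, h⟩ := hA
  simp [finAx, axChoice] at h
  obtain ⟨c, hc⟩ := h.2 ⟨x, hx⟩ (fun y hy => hne _ hy)
    (fun y z u h1 h2 h3 h4 => elts_eq.2 (hdisj _ h1 _ h2 _ h3 h4))
  refine ⟨c.val, c.prop, fun y hy => ?_⟩
  have hyA := hT _ hx _ hy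
  obtain ⟨u, hu1, hu2⟩ := hc ⟨y, hyA⟩ hy
  exact ⟨u.val, hu1.1, hu1.2, fun v h1 h2 => elts_eq.1 (hu2 ⟨v, hT _ hyA _ h1⟩ h1 h2)⟩

theorem PreModel.un_mem (hA : PreModel A) {x y : V} (hx : x ∈ A) (hy : y ∈ A) : un x y ∈ A :=
  hA.sUn_mem (hA.upair_mem hx hy)
theorem PreModel.suc_mem (hA : PreModel A) {x : V} (hx : x ∈ A) : suc x ∈ A :=
  hA.un_mem hx (hA.upair_mem hx hx)
theorem PreModel.opair_mem (hA : PreModel A) {x y : V} (hx : x ∈ A) (hy : y ∈ A) : opair x y ∈ A :=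
  hA.upair_mem (hA.upair_mem hx hx) (hA.upair_mem hx hy)
theorem PreModel.app_mem (hA : PreModel A) {s m a : V} (hs : s ∈ A) (hm : m ∈ A) (ha : a ∈ A) :
    app s m a ∈ A :=
  hA.un_mem hs (hA.upair_mem (hA.opair_mem hm ha) (hA.opair_mem hm ha))

end PreModel

/-! ### Separation and foundation in the universe -/

/-- Every set has a subset consisting of its elements with property `P`. -/
def Sep (P : V → Prop) : Prop := ∀ x : V, ∃ y : V, ∀ z, z ∈ y ↔ z ∈ x ∧ P z

theorem exists_containing {n : ℕ} (p : Fin n → V) : ∃ u : V, ∀ i, p i ∈ u := by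
  induction n with
  | zero => exact ⟨emp V, fun i => i.elim0⟩
  | succ n ih =>
    obtain ⟨u, hu⟩ := ih (fun i => p i.succ)
    refine ⟨un u (upair (p 0) (p 0)), fun i => ?_⟩
    refine Fin.cases ?_ (fun j => ?_) i
    · simp
    · simp [hu]

/-- A property that is given by one formula with parameters in all transitive classes is separable:
the formula is evaluated in a transitive set containing the parameters. The formula is given as a
function of the names of its variables. -/
theorem Sep.of_formula {n : ℕ} (φ : ∀ m, Fin m → (Fin n → Fin m) → Fml m) (p : Fin n → V)
    {P : V → Prop}
    (h : ∀ (D : TransClass V) (m : ℕ) (z : Fin m) (w : Fin n → Fin m) (xs : Fin m → D.Elts),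
      (∀ i, (xs (w i)).val = p i) → ((φ m z w).Realize Empty.elim xs ↔ P (xs z).val)) : Sep P := by
  intro x
  obtain ⟨u, hu⟩ := exists_containing (Matrix.vecCons x p)
  obtain ⟨A, huA, hA⟩ := exists_preModel u
  have hx : ∀ z ∈ x, z ∈ A := fun z hz => hA.tr _ (hA.tr _ huA _ (hu 0)) _ hz
  have hp : ∀ i, p i ∈ A := fun i => hA.tr _ huA _ (hu i.succ)
  obtain ⟨y, hy⟩ := separation_relativized hA.tr (φ (n + 1) 0 Fin.succ) (fun i => ⟨p i, hp i⟩) hx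
  refine ⟨y, fun z => (hy z).trans ?_⟩
  constructor
  · rintro ⟨h1, h2⟩
    exact ⟨h1, (h _ _ _ _ _ (fun i => rfl)).1 h2⟩
  · rintro ⟨h1, h2⟩
    exact ⟨h1, (h _ _ _ _ (Matrix.vecCons ⟨z, hx z h1⟩ _) (fun i => rfl)).2 h2⟩

theorem Sep.mem (a : V) : Sep fun z => z ∈ a :=
  Sep.of_formula (fun _ z w => z ∈ₛ w 0) ![a] fun D m z w xs hq => by simp [hq]

theorem Sep.not_mem (a : V) : Sep fun z => z ∉ a :=
  Sep.of_formula (fun _ z w => ∼(z ∈ₛ w 0)) ![a] fun D m z w xs hq => by simp [hq]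

theorem Sep.not {P : V → Prop} (h : Sep P) : Sep fun z => ¬ P z := by
  intro x
  obtain ⟨y, hy⟩ := h x
  obtain ⟨w, hw⟩ := Sep.not_mem y x
  exact ⟨w, fun z => (hw z).trans (by simp only [hy]; tauto)⟩

/-- Foundation: a separable property of elements of a set has a minimal instance. -/
theorem Sep.exists_min {P : V → Prop} (h : Sep P) {x : V} (hx : ∃ z ∈ x, P z) :
    ∃ z ∈ x, P z ∧ ∀ w ∈ z, w ∈ x → ¬ P w := by
  obtain ⟨y, hy⟩ := h x
  obtain ⟨z, hz⟩ := hx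
  obtain ⟨A, hyA, hA⟩ := exists_preModel y
  obtain ⟨w, hw, hw2⟩ := hA.foundation hyA (fun h => not_mem_emp z (h ▸ (hy z).2 hz))
  exact ⟨w, ((hy w).1 hw).1, ((hy w).1 hw).2, fun u hu hux hP => hw2 u hu ((hy u).2 ⟨hux, hP⟩)⟩

/-- Induction along `∈` on the elements of a transitive set. -/
theorem Sep.induction {P : V → Prop} (h : Sep P) {x : V} (hx : Tr x)
    (step : ∀ z ∈ x, (∀ w ∈ z, P w) → P z) : ∀ z ∈ x, P z := by
  by_contra! hc
  obtain ⟨z, hz, h1, h2⟩ := h.not.exists_min hc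
  exact h1 (step z hz fun w hw => not_not.1 (h2 w hw (hx _ hz _ hw)))

theorem not_mem_self (x : V) : x ∉ x := by
  intro h
  obtain ⟨z, hz, -, h2⟩ := (Sep.mem (upair x x)).exists_min (x := upair x x) ⟨x, by simp⟩
  simp at hz
  subst hz
  exact h2 z h (by simp) (by simp)

theorem mem_asymm {x y : V} (h : x ∈ y) : y ∉ x := by
  intro h'
  obtain ⟨z, hz, -, h2⟩ := (Sep.mem (upair x y)).exists_min (x := upair x y) ⟨x, by simp⟩
  simp at hz
  rcases hz with rfl | rfl
  · exact h2 y h' (by simp) (by simp)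
  · exact h2 x h (by simp) (by simp)

theorem mem_irrefl_three {x y z : V} (h1 : x ∈ y) (h2 : y ∈ z) : z ∉ x := by
  intro h3
  let t := un (upair x y) (upair z z)
  obtain ⟨w, hw, -, h⟩ := (Sep.mem t).exists_min (x := t) ⟨x, by simp [t]⟩
  simp [t] at hw
  rcases hw with (rfl | rfl) | rfl
  · exact h z h3 (by simp [t]) (by simp [t])
  · exact h x h1 (by simp [t]) (by simp [t])
  · exact h y h2 (by simp [t]) (by simp [t])

theorem suc_inj {x y : V} (h : suc x = suc y) : x = y := by
  have h1 : x ∈ suc y := h ▸ (by simp)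
  have h2 : y ∈ suc x := h ▸ (by simp)
  simp at h1 h2
  rcases h1 with h1 | h1
  · rcases h2 with h2 | h2
    · exact (mem_asymm h1 h2).elim
    · exact h2.symm
  · exact h1

theorem suc_ne_emp (x : V) : suc x ≠ emp V := fun h => not_mem_emp x (h ▸ (by simp))

/-! ### Ordinals -/

theorem IsOrd.mem {a x : V} (ha : IsOrd a) (hx : x ∈ a) : IsOrd x := by
  refine ⟨fun y hy z hz => ?_, fun y hy z hz => ha.2 y (ha.1 _ hx _ hy) z (ha.1 _ hx _ hz)⟩
  have hya := ha.1 _ hx _ hy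
  have hza := ha.1 _ hya _ hz
  rcases ha.2 z hza x hx with h | h | h
  · exact h
  · subst h
    exact (mem_asymm hy hz).elim
  · exact (mem_irrefl_three hz hy h).elim

theorem IsOrd.mem_trans {a x y : V} (ha : IsOrd a) (hx : x ∈ a) (hy : y ∈ x) : y ∈ a :=
  ha.1 _ hx _ hy

theorem isOrd_emp : IsOrd (emp V) :=
  ⟨fun _ h => (not_mem_emp _ h).elim, fun _ h => (not_mem_emp _ h).elim⟩

theorem Tr.suc {a : V} (ha : Tr a) : Tr (suc a) := by
  intro y hy z hz
  simp at hy ⊢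
  rcases hy with hy | rfl
  exacts [.inl (ha _ hy _ hz), .inl hz]

theorem IsOrd.suc {a : V} (ha : IsOrd a) : IsOrd (suc a) := by
  refine ⟨ha.1.suc, fun y hy z hz => ?_⟩
  simp at hy hz
  rcases hy with hy | rfl <;> rcases hz with hz | rfl
  · exact ha.2 _ hy _ hz
  · exact .inl hy
  · exact .inr (.inr hz)
  · exact .inr (.inl rfl)

/-- A transitive proper subset of an ordinal is one of its elements. -/
theorem IsOrd.mem_of_subset {a b : V} (hb : IsOrd b) (ha : Tr a) (hab : ∀ x ∈ a, x ∈ b)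
    (hne : a ≠ b) : a ∈ b := by
  have : ∃ z ∈ b, z ∉ a := by
    by_contra! h
    exact hne (set_ext fun z => ⟨hab z, h z⟩)
  obtain ⟨z, hz, h1, h2⟩ := (Sep.not_mem a).exists_min this
  have : z = a := by
    refine set_ext fun w => ⟨fun hw => not_not.1 (h2 w hw (hb.1 _ hz _ hw)), fun hw => ?_⟩
    rcases hb.2 _ (hab w hw) _ hz with h | h | h
    · exact h
    · exact (h1 (h ▸ hw)).elim
    · exact (h1 (ha _ hw _ h)).elim
  exact this ▸ hz

theorem IsOrd.trichotomy {a b : V} (ha : IsOrd a) (hb : IsOrd b) : a ∈ b ∨ a = b ∨ b ∈ a := by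
  obtain ⟨c, hc⟩ := Sep.mem a b
  have hct : Tr c := fun y hy z hz => by
    rw [hc] at hy ⊢
    exact ⟨hb.1 _ hy.1 _ hz, ha.1 _ hy.2 _ hz⟩
  by_cases h1 : c = b
  · by_cases h2 : c = a
    · exact .inr (.inl (h2.symm.trans h1))
    · exact .inr (.inr (h1 ▸ ha.mem_of_subset hct (fun x hx => ((hc x).1 hx).2) h2))
  · have hcb := hb.mem_of_subset hct (fun x hx => ((hc x).1 hx).1) h1
    by_cases h2 : c = a
    · exact .inl (h2 ▸ hcb)
    · have hca := ha.mem_of_subset hct (fun x hx => ((hc x).1 hx).2) h2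
      exact (not_mem_self c ((hc c).2 ⟨hcb, hca⟩)).elim

theorem isOrd_of_tr {a : V} (ha : Tr a) (h : ∀ x ∈ a, IsOrd x) : IsOrd a :=
  ⟨ha, fun y hy z hz => (h y hy).trichotomy (h z hz)⟩

theorem isNat_emp : IsNat (emp V) := ⟨isOrd_emp, .inl rfl, fun _ h => (not_mem_emp _ h).elim⟩

theorem IsNat.suc {m : V} (hm : IsNat m) : IsNat (suc m) := by
  refine ⟨hm.1.suc, .inr ⟨m, by simp, rfl⟩, fun y hy => ?_⟩
  simp at hy
  rcases hy with hy | rfl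
  exacts [hm.2.2 y hy, hm.2.1]

theorem IsNat.mem {m i : V} (hm : IsNat m) (hi : i ∈ m) : IsNat i :=
  ⟨hm.1.mem hi, hm.2.2 i hi, fun y hy => hm.2.2 y (hm.1.1 _ hi _ hy)⟩

theorem IsNat.induction {P : V → Prop} (hP : Sep P) {m : V} (hm : IsNat m) (h0 : P (emp V))
    (hs : ∀ i ∈ m, IsNat i → P i → P (LocalZFC.suc i)) : P m := by
  refine hP.induction hm.suc.1.1 (fun z hz ih => ?_) m (by simp)
  have hz' := hm.suc.mem hz
  rcases hz'.2.1 with rfl | ⟨i, hi, rfl⟩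
  · exact h0
  · refine hs i ?_ (hz'.mem hi) (ih i hi)
    rcases mem_suc.1 hz with h | h
    · exact hm.1.1 _ h _ hi
    · exact h ▸ hi

/-- The natural numbers belong to every model. -/
theorem PreModel.nat_mem {A m : V} (hA : PreModel A) (hm : IsNat m) : m ∈ A :=
  hm.induction (Sep.mem A) hA.emp_mem fun _ _ _ h => hA.suc_mem h

/-! ### Functions -/

/-- `f` is a function with domain `a`. -/
def FunOn (f a : V) : Prop :=
  (∀ p ∈ f, ∃ x ∈ a, ∃ y, p = opair x y) ∧ (∀ x ∈ a, ∃ y, opair x y ∈ f) ∧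
    ∀ x y z, opair x y ∈ f → opair x z ∈ f → y = z

theorem mem_sUn_sUn_of_opair {f x y : V} (h : opair x y ∈ f) :
    x ∈ sUn (sUn f) ∧ y ∈ sUn (sUn f) := by
  have : upair x y ∈ sUn f := mem_sUn.2 ⟨_, h, by simp [opair]⟩
  exact ⟨mem_sUn.2 ⟨_, this, by simp⟩, mem_sUn.2 ⟨_, this, by simp⟩⟩

theorem IsFun.funOn {f a b : V} (h : IsFun f a b) : FunOn f a := by
  refine ⟨fun p hp => ?_, fun x hx => ?_, fun x y z h1 h2 => ?_⟩
  · obtain ⟨x, hx, y, hy, e⟩ := h.1 p hp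
    exact ⟨x, hx, y, e⟩
  · obtain ⟨y, -, hy⟩ := h.2.1 x hx
    exact ⟨y, hy⟩
  · obtain ⟨x', hx, y', hy, e⟩ := h.1 _ h1
    obtain ⟨x'', hx', z', hz, e'⟩ := h.1 _ h2
    simp at e e'
    obtain ⟨rfl, rfl⟩ := e
    obtain ⟨-, rfl⟩ := e'
    exact h.2.2 x hx y hy z hz h1 h2

theorem IsFun.mem {f a b x y : V} (h : IsFun f a b) (hp : opair x y ∈ f) : x ∈ a ∧ y ∈ b := by
  obtain ⟨x', hx, y', hy, e⟩ := h.1 _ hp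
  simp at e
  rw [e.1, e.2]
  exact ⟨hx, hy⟩

theorem FunOn.isFun {f a b : V} (h : FunOn f a) (hb : ∀ x y, opair x y ∈ f → y ∈ b) :
    IsFun f a b := by
  refine ⟨fun p hp => ?_, fun x hx => ?_, fun x hx y hy z hz h1 h2 => h.2.2 x y z h1 h2⟩
  · obtain ⟨x, hx, y, rfl⟩ := h.1 p hp
    exact ⟨x, hx, y, hb _ _ hp, rfl⟩
  · obtain ⟨y, hy⟩ := h.2.1 x hx
    exact ⟨y, hb _ _ hy, hy⟩

theorem FunOn.isFun_sUn {f a : V} (h : FunOn f a) : IsFun f a (sUn (sUn f)) :=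
  h.isFun fun _ _ h => (mem_sUn_sUn_of_opair h).2

theorem FunOn.mem {f a x y : V} (h : FunOn f a) (hp : opair x y ∈ f) : x ∈ a := by
  obtain ⟨x', hx, y', e⟩ := h.1 _ hp
  simp at e
  rw [e.1]
  exact hx

theorem FunOn.ext {f g a : V} (hf : FunOn f a) (hg : FunOn g a)
    (h : ∀ x ∈ a, ∀ y, opair x y ∈ f → opair x y ∈ g) : f = g := by
  refine set_ext fun p => ⟨fun hp => ?_, fun hp => ?_⟩
  · obtain ⟨x, hx, y, rfl⟩ := hf.1 p hp
    exact h x hx y hp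
  · obtain ⟨x, hx, y, rfl⟩ := hg.1 p hp
    obtain ⟨z, hz⟩ := hf.2.1 x hx
    rw [hg.2.2 x y z hp (h x hx z hz)]
    exact hz

theorem sep_dom (j : V) : Sep fun p : V => ∃ x ∈ j, ∃ y, p = opair x y := by
  refine Sep.of_formula (fun _ p w => bex (w 0) fun x => ex fun y => isPair p x y) ![j]
    fun D m z w xs hq => ?_
  simp [hq]
  refine exists_congr fun x => and_congr_right fun hx =>
    ⟨fun ⟨y, hy⟩ => ⟨y.val, hy⟩, fun ⟨y, hy⟩ => ?_⟩
  exact ⟨⟨y, (D.of_opair (hy ▸ (xs z).prop)).2⟩, hy⟩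

/-- The restriction of `f` to `j`. -/
noncomputable def restr (f j : V) : V := Classical.choose (sep_dom j f)

theorem mem_restr {f j p : V} : p ∈ restr f j ↔ p ∈ f ∧ ∃ x ∈ j, ∃ y, p = opair x y :=
  Classical.choose_spec (sep_dom j f) p

@[simp] theorem opair_mem_restr {f j x y : V} : opair x y ∈ restr f j ↔ opair x y ∈ f ∧ x ∈ j := by
  rw [mem_restr]
  simp

theorem FunOn.restr {f a j : V} (hf : FunOn f a) (hj : ∀ x ∈ j, x ∈ a) :
    FunOn (restr f j) j := by
  refine ⟨fun p hp => (mem_restr.1 hp).2, fun x hx => ?_, fun x y z h1 h2 => ?_⟩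
  · obtain ⟨y, hy⟩ := hf.2.1 x (hj x hx)
    exact ⟨y, by simp [hy, hx]⟩
  · simp at h1 h2
    exact hf.2.2 x y z h1.1 h2.1

theorem FunOn.restr_self {f a : V} (hf : FunOn f a) : LocalZFC.restr f a = f :=
  set_ext fun p => ⟨fun hp => (mem_restr.1 hp).1, fun hp => mem_restr.2 ⟨hp, hf.1 p hp⟩⟩

theorem restr_emp (f : V) : restr f (emp V) = emp V := by
  rw [eq_emp_iff]
  intro p hp
  obtain ⟨-, x, hx, -⟩ := mem_restr.1 hp
  exact not_mem_emp x hx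

theorem FunOn.restr_suc {f a i y : V} (hf : FunOn f a) (h : opair i y ∈ f) :
    LocalZFC.restr f (suc i) = app (LocalZFC.restr f i) i y := by
  refine set_ext fun p => ?_
  rw [mem_app, mem_restr, mem_restr]
  constructor
  · rintro ⟨h1, x, hx, z, rfl⟩
    rcases mem_suc.1 hx with hx | rfl
    · exact .inl ⟨h1, x, hx, z, rfl⟩
    · rw [hf.2.2 _ _ _ h h1]
      exact .inr rfl
  · rintro (⟨h1, x, hx, z, rfl⟩ | rfl)
    · exact ⟨h1, x, by simp [hx], z, rfl⟩
    · exact ⟨h, i, by simp, y, rfl⟩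

/-- `t = f ↾ j` -/
def isRestr {n : ℕ} (t f j : Fin n) : Fml n :=
  subset t f ⊓ ball f fun p => p ∈ₛ t ⇔ bex j fun x => ex fun y => isPair p x y

@[simp] theorem realize_isRestr {D : TransClass V} {n : ℕ} {v : Empty → D.Elts}
    {xs : Fin n → D.Elts} {t f j : Fin n} :
    (isRestr t f j).Realize v xs ↔ (xs t).val = restr (xs f).val (xs j).val := by
  simp [isRestr]
  constructor
  · rintro ⟨h1, h2⟩
    refine set_ext fun p => ?_
    rw [mem_restr]
    constructor
    · intro hp
      obtain ⟨x, hx, y, rfl⟩ := (h2 p (h1 p hp)).1 hp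
      exact ⟨h1 _ hp, x, hx, y.val, rfl⟩
    · rintro ⟨hp, x, hx, y, rfl⟩
      exact (h2 _ hp).2 ⟨x, hx, ⟨y, (D.of_opair_mem (xs f).prop hp).2⟩, rfl⟩
  · intro h
    rw [h]
    refine ⟨fun p hp => (mem_restr.1 hp).1, fun p hp => ?_⟩
    rw [mem_restr]
    constructor
    · rintro ⟨-, x, hx, y, rfl⟩
      exact ⟨x, hx, ⟨y, (D.of_opair_mem (xs f).prop hp).2⟩, rfl⟩
    · rintro ⟨x, hx, y, rfl⟩
      exact ⟨hp, x, hx, _, rfl⟩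

theorem sep_restr_mem (f A : V) : Sep fun j : V => restr f j ∈ A := by
  refine Sep.of_formula (fun _ j w => bex (w 1) fun t => isRestr t (w 0) j) ![f, A]
    fun D m z w xs hq => ?_
  simp [hq]

/-- A transitive model contains all finite sequences of elements of its members: by induction on `i`
it contains the restrictions to `i`. The length may be a nonstandard natural number. -/
theorem PreModel.finSeq_mem {A s m B : V} (hA : PreModel A) (hB : B ∈ A) (hm : IsNat m)
    (hs : IsFun s m B) : s ∈ A := by
  rw [← hs.funOn.restr_self]
  refine hm.induction (sep_restr_mem s A) ?_ ?_
  · rw [restr_emp]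
    exact hA.emp_mem
  · intro i hi hn ih
    obtain ⟨y, hyB, hy⟩ := hs.2.1 i hi
    rw [hs.funOn.restr_suc hy]
    exact hA.app_mem ih (hA.nat_mem hn) (hA.tr _ hB _ hyB)

/-! ### Satisfaction and its absoluteness -/

/-- `R` is the set of the functions `s : m → A` with property `X`. -/
def IsRel (R m A : V) (X : V → Prop) : Prop := ∀ s, s ∈ R ↔ IsFun s m A ∧ X s

/-- One step of a satisfaction sequence, by Tarski's clauses. -/
def SatStep (A d i m c R : V) : Prop :=
  (∃ x ∈ m, ∃ y ∈ m, c = cMem x y ∧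
    IsRel R m A fun s => ∃ a ∈ A, ∃ b ∈ A, opair x a ∈ s ∧ opair y b ∈ s ∧ a ∈ b) ∨
  (∃ x ∈ m, ∃ y ∈ m, c = cEq x y ∧ IsRel R m A fun s => ∃ a ∈ A, opair x a ∈ s ∧ opair y a ∈ s) ∨
  (∃ j ∈ i, ∃ c₁ R₁, ent j m c₁ R₁ ∈ d ∧ c = cNot c₁ ∧ IsRel R m A fun s => s ∉ R₁) ∨
  (∃ j ∈ i, ∃ k ∈ i, ∃ c₁ R₁ c₂ R₂, ent j m c₁ R₁ ∈ d ∧ ent k m c₂ R₂ ∈ d ∧ c = cAnd c₁ c₂ ∧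
    IsRel R m A fun s => s ∈ R₁ ∧ s ∈ R₂) ∨
  (∃ j ∈ i, ∃ c₁ R₁, ent j (suc m) c₁ R₁ ∈ d ∧ c = cEx c₁ ∧
    IsRel R m A fun s => ∃ a ∈ A, app s m a ∈ R₁)

/-- `d` is a satisfaction sequence for `(A, ∈)` of length `k`. -/
def SatSeq (A d k : V) : Prop :=
  IsNat k ∧ FunOn d k ∧ ∀ i ∈ k, ∃ m c R, ent i m c R ∈ d ∧ IsNat m ∧ SatStep A d i m c R

/-- `c` codes a formula of arity `m`, and `R` is the set of the assignments satisfying it. -/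
def SatR (A m c R : V) : Prop := ∃ d k, SatSeq A d k ∧ ∃ i ∈ k, ent i m c R ∈ d

/-- `x` is a subset of `A` that is definable over `(A, ∈)` with parameters. -/
def Definable (x A : V) : Prop :=
  (∀ z ∈ x, z ∈ A) ∧ ∃ m c R s, IsNat m ∧ SatR A (suc m) c R ∧ IsFun s m A ∧
    ∀ a ∈ A, a ∈ x ↔ app s m a ∈ R

/-- `y = Def(A)` -/
def IsDef (y A : V) : Prop := ∀ x, x ∈ y ↔ Definable x A

/-- `y` is the value at `γ` that the clauses defining the sequence of the `L_γ` require, where the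
earlier values are those of `f`. -/
def LVal (f γ y : V) : Prop :=
  (γ = emp V ∧ y = emp V) ∨
  (∃ η ∈ γ, γ = suc η ∧ ∃ w, opair η w ∈ f ∧ IsDef y w) ∨
  (¬ ZeroOrSuc γ ∧ ∀ z, z ∈ y ↔ ∃ η ∈ γ, ∃ w, opair η w ∈ f ∧ z ∈ w)

/-- `f` is the sequence of the `L_γ` for `γ ∈ β`. -/
def LSeq (f β : V) : Prop := FunOn f β ∧ ∀ γ ∈ β, ∃ y, opair γ y ∈ f ∧ LVal f γ y

/-- A transitive class that contains the natural numbers, is closed under unions, and contains all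
finite sequences of elements of its members. -/
class TransClass.FinClosed (D : TransClass V) : Prop where
  finSeq : ∀ {s m B : V}, D.carrier B → IsNat m → IsFun s m B → D.carrier s
  sUn : ∀ {x : V}, D.carrier x → D.carrier (sUn x)
  nat : ∀ {m : V}, IsNat m → D.carrier m

/-- A class that also contains the satisfaction sequences and the definable subsets of its members,
so that the construction of `L` is absolute for it. -/
class TransClass.DefClosed (D : TransClass V) : Prop extends D.FinClosed where
  satSeq : ∀ {A d k : V}, D.carrier A → SatSeq A d k → D.carrier d
  definable : ∀ {x A : V}, D.carrier A → Definable x A → D.carrier x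

instance : (TransClass.univ V).DefClosed where
  finSeq _ _ _ := trivial
  sUn _ := trivial
  nat _ := trivial
  satSeq _ _ := trivial
  definable _ _ := trivial

theorem TransClass.of_ent_mem (D : TransClass V) {i m c R d : V} (hd : D.carrier d)
    (h : ent i m c R ∈ d) : D.carrier i ∧ D.carrier m ∧ D.carrier c ∧ D.carrier R := by
  have h1 := D.of_opair_mem hd h
  have h2 := D.of_opair h1.2
  have h3 := D.of_opair h2.2
  exact ⟨h1.1, h2.1, h3.1, h3.2⟩

section Realize

variable {D : TransClass V} {n : ℕ} {v : Empty → D.Elts} {xs : Fin n → D.Elts}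

theorem isRel_elts [D.FinClosed] {R m A : V} (hA : D.carrier A) (hR : D.carrier R) (hm : IsNat m)
    {P : D.Elts → Prop} (X : V → Prop) (h : ∀ s : D.Elts, P s ↔ X s.val) :
    (∀ s : D.Elts, s.val ∈ R ↔ IsFun s.val m A ∧ P s) ↔ IsRel R m A X := by
  constructor
  · intro H s
    constructor
    · intro hs
      have := (H ⟨s, D.down hR hs⟩).1 hs
      exact ⟨this.1, (h _).1 this.2⟩
    · rintro ⟨h1, h2⟩
      exact (H ⟨s, TransClass.FinClosed.finSeq hA hm h1⟩).2 ⟨h1, (h _).2 h2⟩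
  · intro H s
    rw [H, h]

/-- Tarski's clauses are absolute. The arity has to be a natural number in order that `D` contains
the assignments. -/
theorem realize_satStep [D.FinClosed] {A d i m c R : Fin n} (hm : IsNat (xs m).val) :
    (satStep A d i m c R).Realize v xs ↔
      SatStep (xs A).val (xs d).val (xs i).val (xs m).val (xs c).val (xs R).val := by
  simp only [satStep, SatStep, FirstOrder.Language.BoundedFormula.realize_sup,
    FirstOrder.Language.BoundedFormula.realize_inf,
    FirstOrder.Language.BoundedFormula.realize_not, realize_bex, realize_codeMem, realize_codeEq,
    realize_codeNot, realize_codeAnd, realize_codeEx, realize_isRel, realize_pairMem, realize_mem,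
    elts_mem, realize_entry, realize_ex, realize_isSucc, realize_snocMem, Fin.snoc_last,
    Fin.snoc_castSucc, exists_prop, or_assoc]
  have hA := (xs A).prop
  have hR := (xs R).prop
  have hd := (xs d).prop
  refine or_congr ?_ (or_congr ?_ (or_congr ?_ (or_congr ?_ ?_)))
  · refine exists_congr fun x => and_congr_right fun hx => exists_congr fun y =>
      and_congr_right fun hy => and_congr_right fun hc => ?_
    exact isRel_elts hA hR hm _ fun s => by simp only [and_assoc]
  · refine exists_congr fun x => and_congr_right fun hx => exists_congr fun y =>
      and_congr_right fun hy => and_congr_right fun hc => ?_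
    exact isRel_elts hA hR hm _ fun s => Iff.rfl
  · refine exists_congr fun j => and_congr_right fun hj => ?_
    constructor
    · rintro ⟨c₁, R₁, ⟨h1, h2⟩, h3⟩
      exact ⟨c₁.val, R₁.val, h1, h2, (isRel_elts hA hR hm _ fun s => Iff.rfl).1 h3⟩
    · rintro ⟨c₁, R₁, h1, h2, h3⟩
      have := D.of_ent_mem hd h1
      exact ⟨⟨c₁, this.2.2.1⟩, ⟨R₁, this.2.2.2⟩, ⟨h1, h2⟩,
        (isRel_elts hA hR hm _ fun s => Iff.rfl).2 h3⟩
  · refine exists_congr fun j => and_congr_right fun hj => exists_congr fun k =>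
      and_congr_right fun hk => ?_
    constructor
    · rintro ⟨c₁, R₁, c₂, R₂, ⟨⟨h1, h1'⟩, h2⟩, h3⟩
      exact ⟨c₁.val, R₁.val, c₂.val, R₂.val, h1, h1', h2,
        (isRel_elts hA hR hm _ fun s => Iff.rfl).1 h3⟩
    · rintro ⟨c₁, R₁, c₂, R₂, h1, h1', h2, h3⟩
      have := D.of_ent_mem hd h1
      have h' := D.of_ent_mem hd h1'
      exact ⟨⟨c₁, this.2.2.1⟩, ⟨R₁, this.2.2.2⟩, ⟨c₂, h'.2.2.1⟩, ⟨R₂, h'.2.2.2⟩, ⟨⟨h1, h1'⟩, h2⟩,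
        (isRel_elts hA hR hm _ fun s => Iff.rfl).2 h3⟩
  · refine exists_congr fun j => and_congr_right fun hj => ?_
    constructor
    · rintro ⟨m₁, c₁, R₁, ⟨⟨h0, h1⟩, h2⟩, h3⟩
      rw [h0] at h1
      exact ⟨c₁.val, R₁.val, h1, h2, (isRel_elts hA hR hm _ fun s => Iff.rfl).1 h3⟩
    · rintro ⟨c₁, R₁, h1, h2, h3⟩
      have := D.of_ent_mem hd h1
      exact ⟨⟨_, this.2.1⟩, ⟨c₁, this.2.2.1⟩, ⟨R₁, this.2.2.2⟩, ⟨⟨rfl, h1⟩, h2⟩,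
        (isRel_elts hA hR hm _ fun s => Iff.rfl).2 h3⟩

@[simp] theorem realize_exists_isFun [D.FinClosed] {f a : Fin n} :
    (ex fun b => isFun f a b).Realize v xs ↔ FunOn (xs f).val (xs a).val := by
  simp
  constructor
  · rintro ⟨b, hb⟩
    exact hb.funOn
  · intro h
    exact ⟨⟨_, TransClass.FinClosed.sUn (TransClass.FinClosed.sUn (xs f).prop)⟩, h.isFun_sUn⟩

@[simp] theorem realize_isSatSeq [D.FinClosed] {A d k : Fin n} :
    (isSatSeq A d k).Realize v xs ↔ SatSeq (xs A).val (xs d).val (xs k).val := by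
  rw [isSatSeq, FirstOrder.Language.BoundedFormula.realize_inf,
    FirstOrder.Language.BoundedFormula.realize_inf, realize_exists_isFun, realize_isNat,
    realize_ball, SatSeq, and_assoc]
  refine and_congr_right fun _ => and_congr_right fun _ => forall_congr' fun i =>
    forall_congr' fun hi => ?_
  simp only [realize_ex, FirstOrder.Language.BoundedFormula.realize_inf, realize_entry,
    realize_isNat, Fin.snoc_last, Fin.snoc_castSucc]
  constructor
  · rintro ⟨m, c, R, ⟨h1, h2⟩, h3⟩
    rw [realize_satStep (by simpa using h2)] at h3
    exact ⟨m.val, c.val, R.val, h1, h2, by simpa using h3⟩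
  · rintro ⟨m, c, R, h1, h2, h3⟩
    have := D.of_ent_mem (xs d).prop h1
    refine ⟨⟨m, this.2.1⟩, ⟨c, this.2.2.1⟩, ⟨R, this.2.2.2⟩, ⟨h1, h2⟩, ?_⟩
    rw [realize_satStep (by simpa using h2)]
    simpa using h3

@[simp] theorem realize_isSat [D.DefClosed] {A m c R : Fin n} :
    (isSat A m c R).Realize v xs ↔ SatR (xs A).val (xs m).val (xs c).val (xs R).val := by
  simp [isSat, SatR]
  constructor
  · rintro ⟨d, k, h1, i, h2, h3⟩
    exact ⟨d.val, k.val, h1, i, h2, h3⟩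
  · rintro ⟨d, k, h1, i, h2, h3⟩
    exact ⟨⟨d, TransClass.DefClosed.satSeq (xs A).prop h1⟩, ⟨k, TransClass.FinClosed.nat h1.1⟩,
      h1, i, h2, h3⟩

theorem SatR.elts [D.DefClosed] {A m c R : V} (hA : D.carrier A) (h : SatR A m c R) :
    D.carrier c ∧ D.carrier R := by
  obtain ⟨d, k, h1, i, h2, h3⟩ := h
  exact (D.of_ent_mem (TransClass.DefClosed.satSeq hA h1) h3).2.2

@[simp] theorem realize_isDefinable [D.DefClosed] {x A : Fin n} :
    (isDefinable x A).Realize v xs ↔ Definable (xs x).val (xs A).val := by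
  simp only [isDefinable, Definable, FirstOrder.Language.BoundedFormula.realize_inf, realize_subset,
    realize_ex, realize_isNat, realize_isSucc, realize_isSat, realize_isFun, realize_ball,
    FirstOrder.Language.BoundedFormula.realize_iff, realize_mem, elts_mem, realize_snocMem,
    Fin.snoc_last, Fin.snoc_castSucc]
  refine and_congr_right fun _ => ?_
  constructor
  · rintro ⟨m, k, c, R, s, ⟨⟨⟨h1, h2⟩, h3⟩, h4⟩, h5⟩
    rw [h2] at h3
    exact ⟨m.val, c.val, R.val, s.val, h1, h3, h4, h5⟩
  · rintro ⟨m, c, R, s, h1, h3, h4, h5⟩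
    have := h3.elts (xs A).prop
    exact ⟨⟨m, TransClass.FinClosed.nat h1⟩, ⟨_, TransClass.FinClosed.nat h1.suc⟩, ⟨c, this.1⟩,
      ⟨R, this.2⟩, ⟨s, TransClass.FinClosed.finSeq (xs A).prop h1 h4⟩, ⟨⟨⟨h1, rfl⟩, h3⟩, h4⟩, h5⟩

@[simp] theorem realize_isDef [D.DefClosed] {y A : Fin n} :
    (isDef y A).Realize v xs ↔ IsDef (xs y).val (xs A).val := by
  simp [isDef, IsDef]
  constructor
  · intro H x
    constructor
    · intro hx
      exact (H ⟨x, D.down (xs y).prop hx⟩).1 hx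
    · intro hx
      exact (H ⟨x, TransClass.DefClosed.definable (xs A).prop hx⟩).2 hx
  · intro H x
    exact H x.val

@[simp] theorem realize_isLSeq [D.DefClosed] {f β : Fin n} :
    (isLSeq f β).Realize v xs ↔ LSeq (xs f).val (xs β).val := by
  rw [isLSeq, FirstOrder.Language.BoundedFormula.realize_inf, realize_exists_isFun, realize_ball,
    LSeq]
  refine and_congr_right fun _ => forall_congr' fun γ => forall_congr' fun hγ => ?_
  simp only [LVal, FirstOrder.Language.BoundedFormula.realize_inf, realize_ex, realize_pairMem,
    FirstOrder.Language.BoundedFormula.realize_sup, realize_isEmpty, realize_bex, realize_isSucc,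
    realize_isDef, FirstOrder.Language.BoundedFormula.realize_not, realize_isZeroOrSucc,
    realize_all, FirstOrder.Language.BoundedFormula.realize_iff, realize_mem, elts_mem,
    Fin.snoc_last, Fin.snoc_castSucc, exists_prop, or_assoc]
  have hf := (xs f).prop
  have key : ∀ (η : V) (P : V → Prop), (∃ w : D.Elts, opair η w.val ∈ (xs f).val ∧ P w.val) ↔
      ∃ w, opair η w ∈ (xs f).val ∧ P w := by
    intro η P
    constructor
    · rintro ⟨w, hw⟩
      exact ⟨w.val, hw⟩
    · rintro ⟨w, hw⟩
      exact ⟨⟨w, (D.of_opair_mem hf hw.1).2⟩, hw⟩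
  rw [← key γ]
  refine exists_congr fun y => and_congr_right fun hy => or_congr Iff.rfl (or_congr ?_ ?_)
  · refine exists_congr fun η => and_congr_right fun hη => and_congr_right fun _ => ?_
    exact key η fun w => IsDef y.val w
  · refine and_congr_right fun _ => ?_
    have key' : ∀ z : V, (∃ η, η ∈ γ ∧ ∃ w : D.Elts, opair η w.val ∈ (xs f).val ∧ z ∈ w.val) ↔
        ∃ η, η ∈ γ ∧ ∃ w, opair η w ∈ (xs f).val ∧ z ∈ w := fun z =>
      exists_congr fun η => and_congr_right fun hη => key η fun w => z ∈ w
    simp only [key']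
    constructor
    · intro H z
      constructor
      · intro hz
        exact (H ⟨z, D.down y.prop hz⟩).1 hz
      · rintro ⟨η, h1, w, h2, h3⟩
        exact (H ⟨z, D.down (D.of_opair_mem hf h2).2 h3⟩).2 ⟨η, h1, w, h2, h3⟩
    · intro H z
      exact H z.val

end Realize

/-! ### Transitive models -/

/-- `A` is a transitive model of ZFC. -/
structure IsModel (A : V) : Prop where
  pre : PreModel A
  sep : ∀ m c R s, IsNat m → SatR A (suc m) c R → IsFun s m A →
    ∀ x ∈ A, ∃ y ∈ A, ∀ z ∈ A, z ∈ y ↔ z ∈ x ∧ app s m z ∈ R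
  repl : ∀ m c R s, IsNat m → SatR A (suc (suc m)) c R → IsFun s m A →
    ∀ x ∈ A, (∀ u ∈ x, ∀ v ∈ A, ∀ w ∈ A, app (app s m u) (suc m) v ∈ R →
      app (app s m u) (suc m) w ∈ R → v = w) →
    ∃ y ∈ A, ∀ v ∈ A, v ∈ y ↔ ∃ u ∈ x, app (app s m u) (suc m) v ∈ R

section RealizeUniv

variable {n : ℕ} {v : Empty → V} {xs : Fin n → V}

theorem realize_snocMem₂ {w : Empty → (TransClass.univ V).Elts}
    {ys : Fin n → (TransClass.univ V).Elts} {s m a b R : Fin n} :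
    (snocMem₂ s m a b R).Realize w ys ↔
      app (app (ys s).val (ys m).val (ys a).val) (suc (ys m).val) (ys b).val ∈ (ys R).val := by
  simp [snocMem₂]
  constructor
  · rintro ⟨k, t, ⟨h1, h2⟩, h3⟩
    rwa [← h1, ← h2]
  · intro h
    exact ⟨toUniv _, toUniv _, ⟨rfl, rfl⟩, h⟩

theorem realize_isModelZFC {M : Fin n} : (isModelZFC M).Realize v xs ↔ IsModel (xs M) := by
  simp only [isModelZFC, FirstOrder.Language.BoundedFormula.realize_inf, realize_isTrans_iff]
  have h1 : (satSeparation M).Realize v xs ↔ ∀ m c R s, IsNat m → SatR (xs M) (suc m) c R →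
      IsFun s m (xs M) →
      ∀ x ∈ xs M, ∃ y ∈ xs M, ∀ z ∈ xs M, z ∈ y ↔ z ∈ x ∧ app s m z ∈ R := by
    rw [realize_univ]
    simp [satSeparation]
    constructor
    · intro H m c R s hm hs hf
      exact H (toUniv m) (toUniv _) (toUniv c) (toUniv R) (toUniv s) hm rfl hs hf
    · intro H m k c R s hm hk hs hf
      rw [hk] at hs
      exact H m.val c.val R.val s.val hm hs hf
  have h2 : (satReplacement M).Realize v xs ↔ ∀ m c R s, IsNat m → SatR (xs M) (suc (suc m)) c R →
      IsFun s m (xs M) → ∀ x ∈ xs M, (∀ u ∈ x, ∀ v ∈ xs M, ∀ w ∈ xs M,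
        app (app s m u) (suc m) v ∈ R → app (app s m u) (suc m) w ∈ R → v = w) →
      ∃ y ∈ xs M, ∀ v ∈ xs M, v ∈ y ↔ ∃ u ∈ x, app (app s m u) (suc m) v ∈ R := by
    rw [realize_univ]
    simp [satReplacement, realize_snocMem₂, elts_eq]
    constructor
    · intro H m c R s hm hs hf
      exact H (toUniv m) (toUniv _) (toUniv _) (toUniv c) (toUniv R) (toUniv s) hm rfl rfl hs hf
    · intro H m k l c R s hm hk hl hs hf
      rw [hl, hk] at hs
      exact H m.val c.val R.val s.val hm hs hf
  rw [h1, h2]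
  constructor
  · rintro ⟨⟨⟨h1, h2⟩, h3⟩, h4⟩
    exact ⟨(realize_relativize_finAx _ _ h1).1 h2, h3, h4⟩
  · rintro ⟨h1, h2, h3⟩
    exact ⟨⟨⟨h1.tr, (realize_relativize_finAx _ _ h1.tr).2 h1⟩, h2⟩, h3⟩

end RealizeUniv

theorem exists_model (x : V) : ∃ A : V, x ∈ A ∧ IsModel A := by
  have := realize_axiom (V := V) (σ := axLoc) (by simp [LZFC])
  simp only [axLoc, realize_all, realize_ex, FirstOrder.Language.BoundedFormula.realize_inf,
    realize_mem, realize_isModelZFC] at this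
  exact this x

/-! ### Codes of standard formulas, and the schemas in a model -/

section Sequences

/-- The numeral of a standard natural number. -/
noncomputable def num (V : Type*) [setLang.Structure V] [V ⊨ LZFC] : ℕ → V
  | 0 => emp V
  | n + 1 => suc (num V n)

theorem isNat_num (n : ℕ) : IsNat (num V n) := by
  induction n with
  | zero => exact isNat_emp
  | succ n ih => exact ih.suc

theorem mem_num {n : ℕ} {x : V} : x ∈ num V n ↔ ∃ i : Fin n, x = num V i := by
  induction n with
  | zero => simp [num]
  | succ n ih => simp [num, ih, Fin.exists_fin_succ']

theorem num_inj {m n : ℕ} (h : num V m = num V n) : m = n := by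
  have key : ∀ {m n : ℕ}, m < n → num V m ≠ num V n := fun {m n} h' h => by
    have h2 : num V m ∈ num V n := mem_num.2 ⟨⟨m, h'⟩, rfl⟩
    rw [h] at h2
    exact not_mem_self _ h2
  exact le_antisymm (not_lt.1 fun h' => key h' h.symm) (not_lt.1 fun h' => key h' h)

/-- The set coding a tuple of standard length, as a function on a numeral. -/
noncomputable def seq : {n : ℕ} → (Fin n → V) → V
  | 0, _ => emp V
  | n + 1, xs => app (seq fun i : Fin n => xs i.castSucc) (num V n) (xs (Fin.last n))

theorem mem_seq {n : ℕ} {xs : Fin n → V} {p : V} :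
    p ∈ seq xs ↔ ∃ i : Fin n, p = opair (num V i) (xs i) := by
  induction n with
  | zero => simp [seq]
  | succ n ih => simp [seq, ih, Fin.exists_fin_succ']

theorem opair_mem_seq {n : ℕ} {xs : Fin n → V} {i : Fin n} {a : V} :
    opair (num V i) a ∈ seq xs ↔ a = xs i := by
  rw [mem_seq]
  constructor
  · rintro ⟨j, hj⟩
    rw [opair_inj] at hj
    have : i = j := Fin.ext (num_inj hj.1)
    rw [hj.2, this]
  · rintro rfl
    exact ⟨i, rfl⟩

theorem seq_snoc {n : ℕ} (xs : Fin n → V) (a : V) :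
    seq (Fin.snoc xs a : Fin (n + 1) → V) = app (seq xs) (num V n) a := by
  simp [seq]

theorem isFun_seq {n : ℕ} {xs : Fin n → V} {B : V} (h : ∀ i, xs i ∈ B) :
    IsFun (seq xs) (num V n) B := by
  refine ⟨fun p hp => ?_, fun x hx => ?_, fun x hx y _ z _ h1 h2 => ?_⟩
  · obtain ⟨i, rfl⟩ := mem_seq.1 hp
    exact ⟨_, mem_num.2 ⟨i, rfl⟩, _, h i, rfl⟩
  · obtain ⟨i, rfl⟩ := mem_num.1 hx
    exact ⟨_, h i, opair_mem_seq.2 rfl⟩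
  · obtain ⟨i, rfl⟩ := mem_num.1 hx
    rw [opair_mem_seq] at h1 h2
    rw [h1, h2]

end Sequences

section Codes

variable {A : V}

theorem Sep.and {P Q : V → Prop} (hP : Sep P) (hQ : Sep Q) : Sep fun z => P z ∧ Q z := by
  intro x
  obtain ⟨y, hy⟩ := hP x
  obtain ⟨w, hw⟩ := hQ y
  exact ⟨w, fun z => by rw [hw, hy, and_assoc]⟩

/-- `X` is given by one formula, with parameters `p`, in all transitive classes. -/
def DefBy {n : ℕ} (p : Fin n → V) (X : V → Prop) : Prop :=
  ∃ φ : ∀ m, Fin m → (Fin n → Fin m) → Fml m,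
    ∀ (D : TransClass V) (m : ℕ) (z : Fin m) (w : Fin n → Fin m) (xs : Fin m → D.Elts),
      (∀ i, (xs (w i)).val = p i) → ((φ m z w).Realize Empty.elim xs ↔ X (xs z).val)

theorem DefBy.sep {n : ℕ} {p : Fin n → V} {X : V → Prop} (h : DefBy p X) : Sep X := by
  obtain ⟨φ, h⟩ := h
  exact Sep.of_formula φ p h

theorem defBy_mem_rel (A x y : V) : DefBy ![A, x, y] fun s =>
    ∃ a ∈ A, ∃ b ∈ A, opair x a ∈ s ∧ opair y b ∈ s ∧ a ∈ b := by
  refine ⟨fun _ s w => bex (w 0) fun a => bex (w 0) fun b =>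
    pairMem (w 1) a s ⊓ pairMem (w 2) b s ⊓ a ∈ₛ b, fun D k z w xs hq => ?_⟩
  simp only [realize_bex, FirstOrder.Language.BoundedFormula.realize_inf, realize_pairMem,
    realize_mem, elts_mem, Fin.snoc_last, Fin.snoc_castSucc, hq, exists_prop, and_assoc]
  rfl

theorem defBy_eq_rel (A x y : V) : DefBy ![A, x, y] fun s =>
    ∃ a ∈ A, opair x a ∈ s ∧ opair y a ∈ s := by
  refine ⟨fun _ s w => bex (w 0) fun a => pairMem (w 1) a s ⊓ pairMem (w 2) a s,
    fun D k z w xs hq => ?_⟩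
  simp only [realize_bex, FirstOrder.Language.BoundedFormula.realize_inf, realize_pairMem,
    Fin.snoc_last, Fin.snoc_castSucc, hq, exists_prop]
  rfl

theorem defBy_not_mem (R : V) : DefBy ![R] fun s => s ∉ R :=
  ⟨fun _ s w => ∼(s ∈ₛ w 0), fun D k z w xs hq => by simp [hq]⟩

theorem defBy_mem_and (R S : V) : DefBy ![R, S] fun s => s ∈ R ∧ s ∈ S :=
  ⟨fun _ s w => s ∈ₛ w 0 ⊓ s ∈ₛ w 1, fun D k z w xs hq => by simp [hq]⟩

theorem defBy_app_mem (A m R : V) : DefBy ![A, m, R] fun s => ∃ a ∈ A, app s m a ∈ R :=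
  ⟨fun _ s w => bex (w 0) fun a => snocMem s (w 1) a (w 2), fun D k z w xs hq => by simp [hq]⟩

theorem sep_isFun (m A : V) : Sep fun s => IsFun s m A :=
  Sep.of_formula (fun _ s w => isFun s (w 0) (w 1)) ![m, A] fun D k z w xs hq => by simp [hq]

/-- Relations given by separable properties exist, since all finite sequences of elements of `A`
belong to a transitive model containing `A`. -/
theorem exists_isRel {m : V} (hm : IsNat m) {X : V → Prop} (hX : Sep X) : ∃ R, IsRel R m A X := by
  obtain ⟨N, hAN, hN⟩ := exists_preModel A
  obtain ⟨R, hR⟩ := ((sep_isFun m A).and hX) N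
  exact ⟨R, fun s => (hR s).trans ⟨fun h => h.2, fun h => ⟨hN.finSeq_mem hAN hm h.1, h⟩⟩⟩

theorem SatStep.mono {d d' i m c R : V} (hd : ∀ p ∈ d, p ∈ d') (h : SatStep A d i m c R) :
    SatStep A d' i m c R := by
  rcases h with h | h | ⟨j, hj, c₁, R₁, h1, h2⟩ | ⟨j, hj, k, hk, c₁, R₁, c₂, R₂, h1, h1', h2⟩ |
    ⟨j, hj, c₁, R₁, h1, h2⟩
  · exact .inl h
  · exact .inr (.inl h)
  · exact .inr (.inr (.inl ⟨j, hj, c₁, R₁, hd _ h1, h2⟩))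
  · exact .inr (.inr (.inr (.inl ⟨j, hj, k, hk, c₁, R₁, c₂, R₂, hd _ h1, hd _ h1', h2⟩)))
  · exact .inr (.inr (.inr (.inr ⟨j, hj, c₁, R₁, hd _ h1, h2⟩)))

theorem FunOn.app {f a y : V} (hf : FunOn f a) (ha : IsOrd a) : FunOn (app f a y) (suc a) := by
  refine ⟨fun p hp => ?_, fun x hx => ?_, fun x u w h1 h2 => ?_⟩
  · rcases mem_app.1 hp with hp | rfl
    · obtain ⟨x, hx, z, rfl⟩ := hf.1 p hp
      exact ⟨x, by simp [hx], z, rfl⟩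
    · exact ⟨a, by simp, y, rfl⟩
  · rcases mem_suc.1 hx with hx | rfl
    · obtain ⟨z, hz⟩ := hf.2.1 x hx
      exact ⟨z, by simp [hz]⟩
    · exact ⟨y, by simp⟩
  · rw [mem_app, opair_inj] at h1 h2
    rcases h1 with h1 | ⟨rfl, rfl⟩ <;> rcases h2 with h2 | ⟨h3, rfl⟩
    · exact hf.2.2 _ _ _ h1 h2
    · exact (not_mem_self a (h3 ▸ hf.mem h1)).elim
    · exact (not_mem_self _ (hf.mem h2)).elim
    · rfl

/-- A satisfaction sequence can be extended by one step. -/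
theorem SatSeq.extend {d k m c R : V} (h : SatSeq A d k) (hm : IsNat m) (hs : SatStep A d k m c R) :
    SatSeq A (app d k (opair m (opair c R))) (suc k) := by
  have hsub : ∀ p ∈ d, p ∈ LocalZFC.app d k (opair m (opair c R)) := fun p hp => by simp [hp]
  refine ⟨h.1.suc, h.2.1.app h.1.1, fun i hi => ?_⟩
  rcases mem_suc.1 hi with hi | rfl
  · obtain ⟨m', c', R', h1, h2, h3⟩ := h.2.2 i hi
    exact ⟨m', c', R', hsub _ h1, h2, h3.mono hsub⟩
  · exact ⟨m, c, R, by simp [ent], hm, hs.mono hsub⟩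

theorem satSeq_emp (A : V) : SatSeq A (emp V) (emp V) := by
  refine ⟨isNat_emp, ⟨?_, ?_, ?_⟩, ?_⟩ <;> simp

/-- `P` is the satisfaction predicate of an entry of the sequence `d`. -/
def HasEntry (hA : PreModel A) (d k : V) {n : ℕ} (P : (Fin n → hA.cls.Elts) → Prop) : Prop :=
  ∃ i ∈ k, ∃ c R, ent i (num V n) c R ∈ d ∧ ∀ ys, (seq fun i => (ys i).val) ∈ R ↔ P ys

/-- Every satisfaction sequence extends to one with an entry for `P`. -/
def Codable (hA : PreModel A) {n : ℕ} (P : (Fin n → hA.cls.Elts) → Prop) : Prop :=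
  ∀ d k, SatSeq A d k → ∃ d' k', SatSeq A d' k' ∧ (∀ p ∈ d, p ∈ d') ∧ (∀ i ∈ k, i ∈ k') ∧
    HasEntry hA d' k' P

variable {hA : PreModel A} {n : ℕ}

theorem HasEntry.mono {d k d' k' : V} {P : (Fin n → hA.cls.Elts) → Prop} (h : HasEntry hA d k P)
    (hd : ∀ p ∈ d, p ∈ d') (hk : ∀ i ∈ k, i ∈ k') : HasEntry hA d' k' P := by
  obtain ⟨i, hi, c, R, h1, h2⟩ := h
  exact ⟨i, hk i hi, c, R, hd _ h1, h2⟩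

/-- A satisfaction sequence extends to one with an entry for a predicate `P` whose extension is
given by a separable property `X` of sequences that fits one of Tarski's clauses. -/
theorem SatSeq.exists_entry {d k c : V} (h : SatSeq A d k) {P : (Fin n → hA.cls.Elts) → Prop}
    {X : V → Prop} (hX : Sep X) (hs : ∀ R, IsRel R (num V n) A X → SatStep A d k (num V n) c R)
    (hP : ∀ ys : Fin n → hA.cls.Elts, X (seq fun i => (ys i).val) ↔ P ys) :
    ∃ d' k', SatSeq A d' k' ∧ (∀ p ∈ d, p ∈ d') ∧ (∀ i ∈ k, i ∈ k') ∧ HasEntry hA d' k' P := by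
  obtain ⟨R, hR⟩ := exists_isRel (A := A) (isNat_num n) hX
  refine ⟨_, _, h.extend (isNat_num n) (hs R hR), fun p hp => by simp [hp],
    fun i hi => by simp [hi], k, by simp, c, R, by simp [ent], fun ys => ?_⟩
  rw [hR, hP]
  exact and_iff_right (isFun_seq fun i => (ys i).prop)

theorem Codable.congr {P Q : (Fin n → hA.cls.Elts) → Prop} (h : Codable hA P)
    (e : ∀ ys, P ys ↔ Q ys) : Codable hA Q := by
  have : P = Q := funext fun ys => propext (e ys)
  exact this ▸ h

theorem codable_mem (i j : Fin n) : Codable hA fun ys => (ys i).val ∈ (ys j).val := by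
  intro d k h
  refine h.exists_entry (c := cMem (num V i) (num V j))
    (X := fun s => ∃ a ∈ A, ∃ b ∈ A, opair (num V i) a ∈ s ∧ opair (num V j) b ∈ s ∧ a ∈ b)
    (defBy_mem_rel _ _ _).sep ?_ ?_
  · intro R hR
    exact .inl ⟨_, mem_num.2 ⟨i, rfl⟩, _, mem_num.2 ⟨j, rfl⟩, rfl, hR⟩
  · intro ys
    simp only [opair_mem_seq]
    constructor
    · rintro ⟨a, -, b, -, rfl, rfl, h⟩
      exact h
    · intro h
      exact ⟨_, (ys i).prop, _, (ys j).prop, rfl, rfl, h⟩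

theorem codable_eq (i j : Fin n) : Codable hA fun ys => (ys i).val = (ys j).val := by
  intro d k h
  refine h.exists_entry (c := cEq (num V i) (num V j))
    (X := fun s => ∃ a ∈ A, opair (num V i) a ∈ s ∧ opair (num V j) a ∈ s)
    (defBy_eq_rel _ _ _).sep ?_ ?_
  · intro R hR
    exact .inr (.inl ⟨_, mem_num.2 ⟨i, rfl⟩, _, mem_num.2 ⟨j, rfl⟩, rfl, hR⟩)
  · intro ys
    simp only [opair_mem_seq]
    constructor
    · rintro ⟨a, -, rfl, h⟩
      exact h
    · intro h
      exact ⟨_, (ys i).prop, rfl, h⟩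

theorem Codable.not {P : (Fin n → hA.cls.Elts) → Prop} (hP : Codable hA P) :
    Codable hA fun ys => ¬ P ys := by
  intro d k h
  obtain ⟨d', k', h', hd, hk, j, hj, c, R₁, h1, h2⟩ := hP d k h
  obtain ⟨d'', k'', h'', hd', hk', hh⟩ := h'.exists_entry (hA := hA) (n := n) (c := cNot c)
    (X := fun s => s ∉ R₁) (P := fun ys => ¬ P ys) (defBy_not_mem R₁).sep
    (fun R hR => .inr (.inr (.inl ⟨j, hj, c, R₁, h1, rfl, hR⟩))) (fun ys => by rw [h2])
  exact ⟨d'', k'', h'', fun p hp => hd' _ (hd _ hp), fun i hi => hk' _ (hk _ hi), hh⟩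

theorem Codable.and {P Q : (Fin n → hA.cls.Elts) → Prop} (hP : Codable hA P) (hQ : Codable hA Q) :
    Codable hA fun ys => P ys ∧ Q ys := by
  intro d k h
  obtain ⟨d₁, k₁, h₁, hd₁, hk₁, hh₁⟩ := hP d k h
  obtain ⟨d', k', h', hd, hk, hh⟩ := hQ d₁ k₁ h₁
  obtain ⟨i, hi, c₁, R₁, h1, h1'⟩ := hh₁.mono hd hk
  obtain ⟨j, hj, c₂, R₂, h2, h2'⟩ := hh
  obtain ⟨d'', k'', h'', hd', hk', hh⟩ := h'.exists_entry (hA := hA) (n := n) (c := cAnd c₁ c₂)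
    (X := fun s => s ∈ R₁ ∧ s ∈ R₂) (P := fun ys => P ys ∧ Q ys) (defBy_mem_and R₁ R₂).sep
    (fun R hR => .inr (.inr (.inr (.inl ⟨i, hi, j, hj, c₁, R₁, c₂, R₂, h1, h2, rfl, hR⟩))))
    (fun ys => by rw [h1', h2'])
  exact ⟨d'', k'', h'', fun p hp => hd' _ (hd _ (hd₁ _ hp)),
    fun i hi => hk' _ (hk _ (hk₁ _ hi)), hh⟩

theorem Codable.ex {P : (Fin (n + 1) → hA.cls.Elts) → Prop} (hP : Codable hA P) :
    Codable hA fun ys => ∃ a, P (Fin.snoc ys a) := by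
  intro d k h
  obtain ⟨d', k', h', hd, hk, j, hj, c, R₁, h1, h2⟩ := hP d k h
  obtain ⟨d'', k'', h'', hd', hk', hh⟩ := h'.exists_entry (hA := hA) (n := n) (c := cEx c)
    (X := fun s => ∃ a ∈ A, app s (num V n) a ∈ R₁) (P := fun ys => ∃ a, P (Fin.snoc ys a))
    (defBy_app_mem A _ R₁).sep
    (fun R hR => .inr (.inr (.inr (.inr ⟨j, hj, c, R₁, h1, rfl, hR⟩)))) (fun ys => by
      have key : ∀ a : hA.cls.Elts, app (seq fun i => (ys i).val) (num V n) a.val ∈ R₁ ↔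
          P (Fin.snoc ys a) := by
        intro a
        rw [← h2, ← seq_snoc]
        have : (Fin.snoc (fun i => (ys i).val) a.val : Fin (n + 1) → V) =
            fun i => ((Fin.snoc ys a : Fin (n + 1) → hA.cls.Elts) i).val := by
          funext i
          refine Fin.lastCases ?_ (fun j => ?_) i <;> simp
        rw [this]
      constructor
      · rintro ⟨a, ha, h⟩
        exact ⟨⟨a, ha⟩, (key ⟨a, ha⟩).1 h⟩
      · rintro ⟨a, h⟩
        exact ⟨a.val, a.prop, (key a).2 h⟩)
  exact ⟨d'', k'', h'', fun p hp => hd' _ (hd _ hp), fun i hi => hk' _ (hk _ hi), hh⟩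

/-- Every formula has a code, with the correct satisfaction relation. -/
theorem codable_formula (φ : Fml n) : Codable hA fun ys => φ.Realize Empty.elim ys := by
  induction φ with
  | @falsum n =>
    refine (codable_eq (n := n + 1) (Fin.last n) (Fin.last n)).ex.not.congr fun ys => ?_
    simp only [FirstOrder.Language.BoundedFormula.Realize, iff_false, not_not]
    exact ⟨⟨emp V, hA.emp_mem⟩, by simp⟩
  | equal s t =>
    obtain ⟨i, rfl⟩ := exists_term_eq_var s
    obtain ⟨j, rfl⟩ := exists_term_eq_var t
    refine (codable_eq i j).congr fun ys => ?_
    simp [FirstOrder.Language.BoundedFormula.Realize, elts_eq]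
  | rel R ts =>
    cases R
    obtain ⟨i, hi⟩ := exists_term_eq_var (ts 0)
    obtain ⟨j, hj⟩ := exists_term_eq_var (ts 1)
    have : ts = ![.var (.inr i), .var (.inr j)] := by
      funext k; fin_cases k <;> assumption
    subst this
    refine (codable_mem i j).congr fun ys => ?_
    have : (i ∈ₛ j).Realize Empty.elim ys ↔ _ := realize_mem
    exact elts_mem.symm.trans this.symm
  | imp φ ψ ih₁ ih₂ =>
    refine (ih₁.and ih₂.not).not.congr fun ys => ?_
    simp [FirstOrder.Language.BoundedFormula.Realize]
  | all φ ih =>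
    refine ih.not.ex.not.congr fun ys => ?_
    simp [FirstOrder.Language.BoundedFormula.Realize]

theorem exists_satR (hA : PreModel A) (φ : Fml n) : ∃ c R, SatR A (num V n) c R ∧
    ∀ ys : Fin n → hA.cls.Elts, (seq fun i => (ys i).val) ∈ R ↔ φ.Realize Empty.elim ys := by
  obtain ⟨d, k, h, -, -, i, hi, c, R, h1, h2⟩ := codable_formula (hA := hA) φ _ _ (satSeq_emp A)
  exact ⟨c, R, ⟨d, k, h, i, hi, h1⟩, h2⟩

end Codes

section Schemas

variable {A : V}

/-- The class of the elements of a model of ZFC. -/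
abbrev IsModel.cls (hA : IsModel A) : TransClass V := hA.pre.cls

/-- Separation in a model, for all formulas with parameters in it. -/
theorem IsModel.separation (hA : IsModel A) {n : ℕ} (φ : ∀ m, Fin m → (Fin n → Fin m) → Fml m)
    (p : Fin n → V) (hp : ∀ i, p i ∈ A) {P : V → Prop}
    (h : ∀ (m : ℕ) (z : Fin m) (w : Fin n → Fin m) (xs : Fin m → hA.cls.Elts),
      (∀ i, (xs (w i)).val = p i) → ((φ m z w).Realize Empty.elim xs ↔ P (xs z).val))
    {x : V} (hx : x ∈ A) : ∃ y ∈ A, ∀ z, z ∈ y ↔ z ∈ x ∧ P z := by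
  obtain ⟨c, R, h1, h2⟩ := exists_satR hA.pre (φ (n + 1) (Fin.last n) Fin.castSucc)
  obtain ⟨y, hy, H⟩ := hA.sep (num V n) c R (seq p) (isNat_num n) h1 (isFun_seq hp) x hx
  have key : ∀ z ∈ A, app (seq p) (num V n) z ∈ R ↔ P z := by
    intro z hz
    have := (h2 (Fin.snoc (fun i => ⟨p i, hp i⟩) ⟨z, hz⟩)).trans
      (h _ _ _ _ (fun i => by rw [Fin.snoc_castSucc]))
    simpa [seq] using this
  refine ⟨y, hy, fun z => ?_⟩
  by_cases hz : z ∈ A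
  · rw [H z hz, key z hz]
  · exact ⟨fun h => (hz (hA.pre.tr _ hy _ h)).elim, fun h => (hz (hA.pre.tr _ hx _ h.1)).elim⟩

theorem DefBy.separation (hA : IsModel A) {n : ℕ} {p : Fin n → V} {X : V → Prop} (h : DefBy p X)
    (hp : ∀ i, p i ∈ A) {x : V} (hx : x ∈ A) : ∃ y ∈ A, ∀ z, z ∈ y ↔ z ∈ x ∧ X z := by
  obtain ⟨φ, h⟩ := h
  exact hA.separation φ p hp (h _) hx

/-- Replacement in a model, for all formulas with parameters in it. -/
theorem IsModel.replacement (hA : IsModel A) {n : ℕ}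
    (φ : ∀ m, Fin m → Fin m → (Fin n → Fin m) → Fml m)
    (p : Fin n → V) (hp : ∀ i, p i ∈ A) {P : V → V → Prop}
    (h : ∀ (m : ℕ) (u v : Fin m) (w : Fin n → Fin m) (xs : Fin m → hA.cls.Elts),
      (∀ i, (xs (w i)).val = p i) → ((φ m u v w).Realize Empty.elim xs ↔ P (xs u).val (xs v).val))
    {x : V} (hx : x ∈ A)
    (hP : ∀ u ∈ x, ∀ v ∈ A, ∀ w ∈ A, P u v → P u w → v = w) :
    ∃ y ∈ A, ∀ v, v ∈ y ↔ v ∈ A ∧ ∃ u ∈ x, P u v := by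
  obtain ⟨c, R, h1, h2⟩ := exists_satR hA.pre
    (φ (n + 2) (Fin.last n).castSucc (Fin.last (n + 1)) fun i => i.castSucc.castSucc)
  have key : ∀ u ∈ A, ∀ v ∈ A, app (app (seq p) (num V n) u) (suc (num V n)) v ∈ R ↔ P u v := by
    intro u hu v hv
    have := (h2 (Fin.snoc (Fin.snoc (fun i => ⟨p i, hp i⟩) ⟨u, hu⟩ : Fin (n + 1) → hA.cls.Elts)
      ⟨v, hv⟩)).trans
      (h _ _ _ _ _ (fun i => by rw [Fin.snoc_castSucc, Fin.snoc_castSucc]))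
    simpa [seq, num] using this
  have hxA : ∀ u ∈ x, u ∈ A := fun u hu => hA.pre.tr _ hx _ hu
  obtain ⟨y, hy, H⟩ := hA.repl (num V n) c R (seq p) (isNat_num n) h1 (isFun_seq hp) x hx
    (fun u hu v hv w hw h3 h4 => hP u hu v hv w hw ((key u (hxA u hu) v hv).1 h3)
      ((key u (hxA u hu) w hw).1 h4))
  refine ⟨y, hy, fun v => ?_⟩
  constructor
  · intro hv
    have hvA := hA.pre.tr _ hy _ hv
    obtain ⟨u, hu, h3⟩ := (H v hvA).1 hv
    exact ⟨hvA, u, hu, (key u (hxA u hu) v hvA).1 h3⟩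
  · rintro ⟨hvA, u, hu, h3⟩
    exact (H v hvA).2 ⟨u, hu, (key u (hxA u hu) v hvA).2 h3⟩

end Schemas

/-! ### Models contain the satisfaction sequences and definable subsets of their elements -/

section

variable {A : V}

theorem IsModel.tr (hA : IsModel A) : Tr A := hA.pre.tr

/-- Some set in the model contains all pairs of elements of `U`: the double power set of `U` in the
model. -/
theorem IsModel.exists_pairs (hA : IsModel A) {U : V} (hU : U ∈ A) :
    ∃ W ∈ A, ∀ x ∈ U, ∀ y ∈ U, opair x y ∈ W := by
  obtain ⟨p, hp, h1⟩ := hA.pre.exists_power hU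
  obtain ⟨q, hq, h2⟩ := hA.pre.exists_power hp
  refine ⟨q, hq, fun x hx y hy => ?_⟩
  have hxA := hA.tr _ hU _ hx
  have hyA := hA.tr _ hU _ hy
  rw [h2]
  refine ⟨hA.pre.opair_mem hxA hyA, fun w hw => ?_⟩
  rw [h1]
  rcases mem_upair.1 hw with rfl | rfl
  · exact ⟨hA.pre.upair_mem hxA hxA, fun z hz => by
      rcases mem_upair.1 hz with rfl | rfl <;> exact hx⟩
  · exact ⟨hA.pre.upair_mem hxA hyA, fun z hz => by
      rcases mem_upair.1 hz with rfl | rfl <;> assumption⟩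

/-- A model contains the definable finitary relations on its elements `B`. -/
theorem IsModel.rel_mem (hA : IsModel A) {B m R : V} (hB : B ∈ A) (hm : IsNat m) {n : ℕ}
    {p : Fin n → V} {X : V → Prop} (hX : DefBy p X) (hp : ∀ i, p i ∈ A) (hR : IsRel R m B X) :
    R ∈ A := by
  obtain ⟨W, hW, h1⟩ := hA.exists_pairs (hA.pre.un_mem (hA.pre.nat_mem hm) hB)
  obtain ⟨F, hF, h2⟩ := hA.pre.exists_power hW
  obtain ⟨G, hG, h3⟩ := hX.separation hA hp hF
  obtain ⟨H, hH, h4⟩ := hA.separation (fun _ s w => isFun s (w 0) (w 1)) ![m, B]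
    (by simp [Fin.forall_fin_two, hB, hA.pre.nat_mem hm]) (P := fun s => IsFun s m B)
    (fun k z w xs hq => by simp [hq]) hG
  have : R = H := set_ext fun s => by
    rw [hR, h4, h3, h2]
    refine ⟨fun h => ⟨⟨⟨hA.pre.finSeq_mem hB hm h.1, fun q hq => ?_⟩, h.2⟩, h.1⟩,
      fun h => ⟨h.2, h.1.2⟩⟩
    obtain ⟨x, hx, y, hy, rfl⟩ := h.1.1 q hq
    exact h1 x (by simp [hx]) y (by simp [hy])
  exact this ▸ hH

/-- A model contains the satisfaction sequences of its elements `B`, by induction on their length: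
each step adds a relation that is definable from the earlier ones. -/
theorem IsModel.satSeq_mem (hA : IsModel A) {B d k : V} (hB : B ∈ A) (h : SatSeq B d k) :
    d ∈ A := by
  rw [← h.2.1.restr_self]
  refine h.1.induction (sep_restr_mem d A) ?_ fun i hi hn ih => ?_
  · rw [restr_emp]
    exact hA.pre.emp_mem
  · obtain ⟨m, c, R, hent, hm, h2⟩ := h.2.2 i hi
    rw [h.2.1.restr_suc hent]
    have hmA := hA.pre.nat_mem hm
    have earlier : ∀ {j m c R}, j ∈ i → ent j m c R ∈ d → c ∈ A ∧ R ∈ A := fun {j m c R} hj h =>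
      (hA.cls.of_ent_mem ih (opair_mem_restr.2 ⟨h, hj⟩)).2.2
    have hc1 := hA.pre.nat_mem (isNat_emp (V := V)).suc
    have hc2 := hA.pre.nat_mem (isNat_emp (V := V)).suc.suc
    have hc3 := hA.pre.nat_mem (isNat_emp (V := V)).suc.suc.suc
    have hc4 := hA.pre.nat_mem (isNat_emp (V := V)).suc.suc.suc.suc
    suffices c ∈ A ∧ R ∈ A from hA.pre.app_mem ih (hA.pre.nat_mem hn)
      (hA.pre.opair_mem hmA (hA.pre.opair_mem this.1 this.2))
    rcases h2 with ⟨x, hx, y, hy, rfl, h⟩ | ⟨x, hx, y, hy, rfl, h⟩ | ⟨j, hj, c₁, R₁, h1, rfl, h⟩ |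
      ⟨j, hj, k, hk, c₁, R₁, c₂, R₂, h1, h1', rfl, h⟩ | ⟨j, hj, c₁, R₁, h1, rfl, h⟩
    · have hxA := hA.tr _ hmA _ hx
      have hyA := hA.tr _ hmA _ hy
      exact ⟨hA.pre.opair_mem hA.pre.emp_mem (hA.pre.opair_mem hxA hyA),
        hA.rel_mem hB hm (defBy_mem_rel B x y) (by simp [Fin.forall_fin_succ, hB, hxA, hyA]) h⟩
    · have hxA := hA.tr _ hmA _ hx
      have hyA := hA.tr _ hmA _ hy
      exact ⟨hA.pre.opair_mem hc1 (hA.pre.opair_mem hxA hyA),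
        hA.rel_mem hB hm (defBy_eq_rel B x y) (by simp [Fin.forall_fin_succ, hB, hxA, hyA]) h⟩
    · have := earlier hj h1
      exact ⟨hA.pre.opair_mem hc2 this.1,
        hA.rel_mem hB hm (defBy_not_mem R₁) (by simp [this]) h⟩
    · have := earlier hj h1
      have h' := earlier hk h1'
      exact ⟨hA.pre.opair_mem hc3 (hA.pre.opair_mem this.1 h'.1),
        hA.rel_mem hB hm (defBy_mem_and R₁ R₂) (by simp [Fin.forall_fin_succ, this, h']) h⟩
    · have := earlier hj h1
      exact ⟨hA.pre.opair_mem hc4 this.1,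
        hA.rel_mem hB hm (defBy_app_mem B m R₁) (by simp [Fin.forall_fin_succ, this, hB, hmA]) h⟩

theorem IsModel.definable_mem (hA : IsModel A) {x B : V} (hB : B ∈ A) (h : Definable x B) :
    x ∈ A := by
  obtain ⟨hxB, m, c, R, s, hm, ⟨d, k, h1, i, h2, h3⟩, hs, h⟩ := h
  have hR : R ∈ A := (hA.cls.of_ent_mem (hA.satSeq_mem hB h1) h3).2.2.2
  obtain ⟨y, hy, hy'⟩ := hA.separation (fun _ a w => snocMem (w 0) (w 1) a (w 2)) ![s, m, R]
    (by simpa [Fin.forall_fin_succ, hA.pre.nat_mem hm, hA.pre.finSeq_mem hB hm hs] using hR)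
    (P := fun a => app s m a ∈ R) (fun k z w xs hq => by simp [hq]) hB
  have : x = y := set_ext fun a => by
    rw [hy']
    exact ⟨fun ha => ⟨hxB a ha, (h a (hxB a ha)).1 ha⟩, fun ha => (h a ha.1).2 ha.2⟩
  exact this ▸ hy

instance IsModel.defClosed (hA : IsModel A) : hA.cls.DefClosed where
  finSeq hB hm hs := hA.pre.finSeq_mem hB hm hs
  sUn h := hA.pre.sUn_mem h
  nat h := hA.pre.nat_mem h
  satSeq hB h := hA.satSeq_mem hB h
  definable hB h := hA.definable_mem hB h

theorem IsModel.def_mem (hA : IsModel A) {y B : V} (hB : B ∈ A) (h : IsDef y B) : y ∈ A := by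
  obtain ⟨p, hp, h1⟩ := hA.pre.exists_power hB
  obtain ⟨w, hw, hw'⟩ := hA.separation (fun _ a w => isDefinable a (w 0)) ![B]
    (by simpa using hB) (P := fun a => Definable a B) (fun k z w xs hq => by simp [hq]) hp
  have : y = w := set_ext fun x => by
    rw [hw', h, h1]
    exact ⟨fun hx => ⟨⟨hA.definable_mem hB hx, hx.1⟩, hx⟩, fun hx => hx.2⟩
  exact this ▸ hw

end

/-! ### Absoluteness of the constructible hierarchy -/

/-- Two functions on ordinals agree on their common domain if each common value is determined by
the earlier ones. -/
theorem FunOn.agree {f g β β' : V} (hβ : IsOrd β) (hβ' : IsOrd β') (hf : FunOn f β)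
    (hg : FunOn g β')
    (step : ∀ γ ∈ β, γ ∈ β' → (∀ η ∈ γ, ∀ y, opair η y ∈ f ↔ opair η y ∈ g) →
      ∀ y, opair γ y ∈ f → opair γ y ∈ g) :
    ∀ γ ∈ β, γ ∈ β' → ∀ y, opair γ y ∈ f ↔ opair γ y ∈ g := by
  have hsep : Sep fun γ => γ ∈ β' → ∀ y, opair γ y ∈ f ↔ opair γ y ∈ g := by
    refine Sep.of_formula (fun _ γ w => γ ∈ₛ w 0 ⟹ all fun y =>
      pairMem γ y (w 1) ⇔ pairMem γ y (w 2)) ![β', f, g] fun D m z w xs hq => ?_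
    simp [hq]
    refine forall_congr' fun _ => ⟨fun H y => ?_, fun H y => H y.val⟩
    have h1 : D.carrier f := by simpa [hq] using (xs (w 1)).prop
    have h2 : D.carrier g := by simpa [hq] using (xs (w 2)).prop
    exact ⟨fun h => (H ⟨y, (D.of_opair_mem h1 h).2⟩).1 h,
      fun h => (H ⟨y, (D.of_opair_mem h2 h).2⟩).2 h⟩
  refine hsep.induction hβ.1 fun γ hγ ih hγ' => ?_
  have := step γ hγ hγ' fun η hη => ih η hη (hβ'.mem_trans hγ' hη)
  intro y
  refine ⟨this y, fun hy => ?_⟩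
  obtain ⟨z, hz⟩ := hf.2.1 γ hγ
  rw [hg.2.2 _ _ _ hy (this z hz)]
  exact hz

theorem LVal.congr {f g γ y : V} (h : LVal f γ y)
    (e : ∀ η ∈ γ, ∀ y, opair η y ∈ f ↔ opair η y ∈ g) : LVal g γ y := by
  rcases h with h | ⟨η, hη, rfl, w, hw, h⟩ | ⟨h1, h2⟩
  · exact .inl h
  · exact .inr (.inl ⟨η, hη, rfl, w, (e η hη w).1 hw, h⟩)
  · refine .inr (.inr ⟨h1, fun z => (h2 z).trans ?_⟩)
    exact exists_congr fun η => and_congr_right fun hη => exists_congr fun w =>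
      and_congr_left fun _ => e η hη w

theorem LVal.unique {f β γ y y' : V} (hf : FunOn f β) (h : LVal f γ y) (h' : LVal f γ y') :
    y = y' := by
  rcases h with ⟨h, rfl⟩ | ⟨η, hη, h0, w, hw, h⟩ | ⟨h1, h2⟩ <;>
    rcases h' with ⟨k, rfl⟩ | ⟨ζ, hζ, k0, u, hu, k⟩ | ⟨k1, k2⟩
  · rfl
  · exact (suc_ne_emp _ (k0.symm.trans h)).elim
  · exact (k1 (.inl h)).elim
  · exact (suc_ne_emp _ (h0.symm.trans k)).elim
  · obtain rfl := suc_inj (h0.symm.trans k0)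
    obtain rfl := hf.2.2 _ _ _ hw hu
    exact set_ext fun z => by rw [h, k]
  · exact (k1 (.inr ⟨η, hη, h0⟩)).elim
  · exact (h1 (.inl k)).elim
  · exact (h1 (.inr ⟨ζ, hζ, k0⟩)).elim
  · exact set_ext fun z => by rw [h2, k2]

theorem LSeq.lVal {f β γ y : V} (h : LSeq f β) (hy : opair γ y ∈ f) : LVal f γ y := by
  obtain ⟨z, hz, h'⟩ := h.2 γ (h.1.mem hy)
  rwa [h.1.2.2 _ _ _ hy hz]

theorem LSeq.agree {f g β β' : V} (hβ : IsOrd β) (hβ' : IsOrd β') (hf : LSeq f β)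
    (hg : LSeq g β') : ∀ γ ∈ β, γ ∈ β' → ∀ y, opair γ y ∈ f ↔ opair γ y ∈ g := by
  refine hf.1.agree hβ hβ' hg.1 fun γ hγ hγ' ih y hy => ?_
  obtain ⟨z, hz, h⟩ := hg.2 γ hγ'
  rw [LVal.unique hg.1 ((hf.lVal hy).congr ih) h]
  exact hz

theorem LSeq.restr {f β γ : V} (h : LSeq f β) (hγ : Tr γ) (hs : ∀ x ∈ γ, x ∈ β) :
    LSeq (restr f γ) γ := by
  refine ⟨h.1.restr hs, fun η hη => ?_⟩
  obtain ⟨y, hy, h'⟩ := h.2 η (hs η hη)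
  exact ⟨y, by simp [hy, hη], h'.congr fun ζ hζ w => by simp [hγ _ hη _ hζ]⟩

theorem LSeq.unique {f g β : V} (hβ : IsOrd β) (hf : LSeq f β) (hg : LSeq g β) : f = g :=
  hf.1.ext hg.1 fun x hx y => (hf.agree hβ hβ hg x hx hx y).1

theorem suc_mem_of_limit {γ x : V} (hγ : IsOrd γ) (h : ¬ ZeroOrSuc γ) (hx : x ∈ γ) : suc x ∈ γ := by
  rcases (hγ.mem hx).suc.trichotomy hγ with h' | h' | h'
  · exact h'
  · exact (h (.inr ⟨x, hx, h'.symm⟩)).elim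
  · rcases mem_suc.1 h' with h' | rfl
    · exact (mem_asymm hx h').elim
    · exact (not_mem_self _ hx).elim

section

variable {A : V}

/-- The value of the constructible hierarchy at `γ` is in a model with the sequence of the earlier
values. -/
theorem IsModel.lVal_mem (hA : IsModel A) {f γ y : V} (hf : LocalZFC.restr f γ ∈ A)
    (h : LVal f γ y) : y ∈ A := by
  have key : ∀ {η w}, η ∈ γ → opair η w ∈ f → w ∈ A := fun hη hw =>
    (hA.cls.of_opair_mem hf (opair_mem_restr.2 ⟨hw, hη⟩)).2
  rcases h with ⟨-, rfl⟩ | ⟨η, hη, -, w, hw, h⟩ | ⟨-, h⟩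
  · exact hA.pre.emp_mem
  · exact hA.def_mem (key hη hw) h
  · obtain ⟨u, hu, hu'⟩ := hA.separation (fun _ z w => ex fun η => ex fun v =>
        pairMem η v (w 0) ⊓ z ∈ₛ v)
        ![LocalZFC.restr f γ] (by simpa using hf)
        (P := fun z => ∃ η w, opair η w ∈ LocalZFC.restr f γ ∧ z ∈ w) (fun k z w xs hq => by
          simp only [realize_ex, FirstOrder.Language.BoundedFormula.realize_inf, realize_pairMem,
            realize_mem, elts_mem, Fin.snoc_last, Fin.snoc_castSucc, hq]
          constructor
          · rintro ⟨η, v, h1, h2⟩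
            exact ⟨η.val, v.val, h1, h2⟩
          · rintro ⟨η, v, h1, h2⟩
            have := hA.cls.of_opair_mem hf h1
            exact ⟨⟨η, this.1⟩, ⟨v, this.2⟩, h1, h2⟩)
        (hA.pre.sUn_mem (hA.pre.sUn_mem (hA.pre.sUn_mem hf)))
    have : y = u := set_ext fun z => by
      rw [hu', h]
      constructor
      · rintro ⟨η, hη, w, hw, hz⟩
        have := opair_mem_restr.2 ⟨hw, hη⟩
        exact ⟨mem_sUn.2 ⟨w, (mem_sUn_sUn_of_opair this).2, hz⟩, η, w, this, hz⟩
      · rintro ⟨-, η, w, hw, hz⟩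
        rw [opair_mem_restr] at hw
        exact ⟨η, hw.2, w, hw.1, hz⟩
    exact this ▸ hu

/-- The constructible hierarchy up to an ordinal of a model is an element of the model. -/
theorem IsModel.lSeq_mem (hA : IsModel A) {f β : V} (hβ : IsOrd β) (hβA : β ∈ A) (hf : LSeq f β) :
    f ∈ A := by
  have hsub : ∀ γ ∈ suc β, ∀ x ∈ γ, x ∈ β := fun γ hγ x hx => by
    rcases mem_suc.1 hγ with h | rfl
    exacts [hβ.mem_trans h hx, hx]
  have main : ∀ γ ∈ suc β, LocalZFC.restr f γ ∈ A := by
    refine (sep_restr_mem f A).induction hβ.1.suc fun γ hγ ih => ?_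
    have hγo := hβ.suc.mem hγ
    by_cases hγz : ZeroOrSuc γ
    · rcases hγz with rfl | ⟨η, hη, rfl⟩
      · rw [restr_emp]
        exact hA.pre.emp_mem
      · obtain ⟨y, hy, h⟩ := hf.2 η (hsub _ hγ η hη)
        rw [hf.1.restr_suc hy]
        exact hA.pre.app_mem (ih η hη) (hA.tr _ hβA _ (hsub _ hγ η hη)) (hA.lVal_mem (ih η hη) h)
    · -- At a limit, Replacement collects the earlier sequences, and their union is `f ↾ γ`.
      have hγA : γ ∈ A := hA.tr _ (hA.pre.suc_mem hβA) _ hγ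
      have huniq : ∀ u ∈ γ, ∀ v, LSeq v u → v = LocalZFC.restr f u := fun u hu v hv =>
        hv.unique (hγo.mem hu) (hf.restr (hγo.mem hu).1 fun x hx =>
          hsub _ hγ _ (hγo.mem_trans hu hx))
      obtain ⟨S, hS, hS'⟩ := hA.replacement (n := 0) (fun _ u v _ => isLSeq v u) ![]
        (fun i => i.elim0) (P := fun u v => LSeq v u) (fun k u v w xs hq => by simp) hγA
        (fun u hu v _ w _ h1 h2 => (huniq u hu v h1).trans (huniq u hu w h2).symm)
      have : LocalZFC.restr f γ = sUn S := by
        refine set_ext fun p => ?_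
        rw [mem_sUn, mem_restr]
        constructor
        · rintro ⟨hp, x, hx, y, rfl⟩
          have hx' := suc_mem_of_limit hγo hγz hx
          refine ⟨LocalZFC.restr f (suc x), (hS' _).2 ⟨ih _ hx', suc x, hx', ?_⟩, by simp [hp]⟩
          exact hf.restr (hγo.mem hx').1 fun z hz => hsub _ hγ _ (hγo.mem_trans hx' hz)
        · rintro ⟨v, hv, hp⟩
          obtain ⟨-, u, hu, h⟩ := (hS' v).1 hv
          rw [huniq u hu v h, mem_restr] at hp
          obtain ⟨hp, x, hx, y, rfl⟩ := hp
          exact ⟨hp, x, hγo.mem_trans hu hx, y, rfl⟩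
      rw [this]
      exact hA.pre.sUn_mem hS
  have := main β (by simp)
  rwa [hf.1.restr_self] at this

end

/-! ### The well-ordering theorem in a model -/

section WellOrder

variable {A P c y : V}

/-- `v` is the element that the choice set `c` selects from the elements of `y` that are not among
the values of `h` below `ξ`. The set `P` contains the subsets of `y` from which `c` selects. -/
def Step (P c y h ξ v : V) : Prop :=
  ∃ b ∈ P, v ∈ b ∧ opair b v ∈ c ∧ ∀ a ∈ y, a ∈ b ↔ ¬ ∃ ζ ∈ ξ, opair ζ a ∈ h

/-- `h` enumerates elements of `y` along the ordinal `η` by repeated choice. -/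
def Good (P c y h η : V) : Prop :=
  IsOrd η ∧ IsFun h η y ∧ ∀ ξ ∈ η, ∃ v ∈ y, opair ξ v ∈ h ∧ Step P c y h ξ v

/-- The formula expressing `Step`. -/
def stepFml {n : ℕ} (P c y h ξ v : Fin n) : Fml n :=
  bex P fun b => v ∈ₛ b ⊓ pairMem b v c ⊓
    ball y fun a => a ∈ₛ b ⇔ ∼(bex ξ fun ζ => pairMem ζ a h)

/-- The formula expressing `Good`. -/
def goodFml {n : ℕ} (P c y h η : Fin n) : Fml n :=
  isOrd η ⊓ isFun h η y ⊓ ball η fun ξ => bex y fun v => pairMem ξ v h ⊓ stepFml P c y h ξ v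

section

variable {D : TransClass V} {n : ℕ} {v : Empty → D.Elts} {xs : Fin n → D.Elts}

@[simp] theorem realize_stepFml {P c y h ξ u : Fin n} : (stepFml P c y h ξ u).Realize v xs ↔
    Step (xs P).val (xs c).val (xs y).val (xs h).val (xs ξ).val (xs u).val := by
  simp [stepFml, Step, and_assoc, and_left_comm]

@[simp] theorem realize_goodFml {P c y h η : Fin n} : (goodFml P c y h η).Realize v xs ↔
    Good (xs P).val (xs c).val (xs y).val (xs h).val (xs η).val := by
  simp [goodFml, Good, and_assoc, and_left_comm]

end

/-- The data for an enumeration of `y` in the model `A`: the power set `P` of `y` in `A`, and a set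
`c` that selects one element `v` of each nonempty `b ∈ P`, in the form of a pair `(b, v) ∈ c`. -/
structure ChoiceData (A P c y : V) : Prop where
  mem_y : y ∈ A
  mem_P : P ∈ A
  mem_c : c ∈ A
  power : ∀ z, z ∈ P ↔ z ∈ A ∧ ∀ w ∈ z, w ∈ y
  exists_choice : ∀ b ∈ P, b ≠ emp V → ∃ v ∈ b, opair b v ∈ c
  unique : ∀ b ∈ P, ∀ v ∈ b, ∀ w ∈ b, opair b v ∈ c → opair b w ∈ c → v = w

/-- The choice set exists by the axiom of choice for the disjoint sets `{b} × b`. -/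
theorem IsModel.exists_choiceData (hA : IsModel A) (hy : y ∈ A) : ∃ P c, ChoiceData A P c y := by
  obtain ⟨P, hP, hP'⟩ := hA.pre.exists_power hy
  obtain ⟨B, hB, hB'⟩ := hA.exists_pairs (hA.pre.un_mem hP hy)
  obtain ⟨Q, hQ, hQ'⟩ := hA.pre.exists_power hB
  obtain ⟨F, hF, hF'⟩ := hA.separation (fun _ t w => bex (w 0) fun b => ∼(isEmpty b) ⊓
      ball (w 1) fun p => p ∈ₛ t ⇔ bex b fun a => isPair p b a) ![P, B]
    (by simp [Fin.forall_fin_two, hP, hB])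
    (P := fun t => ∃ b ∈ P, b ≠ emp V ∧ ∀ p ∈ B, p ∈ t ↔ ∃ a ∈ b, p = opair b a)
    (fun k z w xs hq => by simp [hq, and_left_comm]) hQ
  have hpair : ∀ b ∈ P, ∀ a ∈ b, opair b a ∈ B := fun b hb a ha =>
    hB' b (by simp [hb]) a (by simp [((hP' b).1 hb).2 a ha])
  have hF'' : ∀ t ∈ F, ∃ b ∈ P, b ≠ emp V ∧ ∀ p, p ∈ t ↔ ∃ a ∈ b, p = opair b a := by
    intro t ht
    obtain ⟨htQ, b, hb, hne, h⟩ := (hF' t).1 ht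
    refine ⟨b, hb, hne, fun p => ⟨fun hp => (h p (((hQ' t).1 htQ).2 p hp)).1 hp, ?_⟩⟩
    rintro ⟨a, ha, rfl⟩
    exact (h _ (hpair b hb a ha)).2 ⟨a, ha, rfl⟩
  have hmem : ∀ b ∈ P, b ≠ emp V → ∃ t ∈ F, ∀ p, p ∈ t ↔ ∃ a ∈ b, p = opair b a := by
    intro b hb hne
    obtain ⟨t, ht, ht'⟩ := hA.separation (fun _ p w => bex (w 0) fun a => isPair p (w 0) a) ![b]
      (by simpa using hA.tr _ hP _ hb) (P := fun p => ∃ a ∈ b, p = opair b a)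
      (fun k z w xs hq => by simp [hq]) hB
    refine ⟨t, (hF' t).2 ⟨(hQ' t).2 ⟨ht, fun w hw => ((ht' w).1 hw).1⟩, b, hb, hne,
      fun p hp => ?_⟩, fun p => ?_⟩
    · rw [ht']
      exact and_iff_right hp
    · rw [ht']
      refine and_iff_right_of_imp ?_
      rintro ⟨a, ha, rfl⟩
      exact hpair b hb a ha
  obtain ⟨c, hc, hc'⟩ := hA.pre.choice hF (fun t ht => by
      obtain ⟨b, hb, hne, h⟩ := hF'' t ht
      intro h0
      have : ∃ a, a ∈ b := by
        by_contra! h1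
        exact hne (eq_emp_iff.2 h1)
      obtain ⟨a, ha⟩ := this
      exact not_mem_emp _ (h0 ▸ (h _).2 ⟨a, ha, rfl⟩))
    (fun t ht t' ht' u hu hu' => by
      obtain ⟨b, hb, hne, h⟩ := hF'' t ht
      obtain ⟨b', hb', hne', h'⟩ := hF'' t' ht'
      obtain ⟨a, ha, rfl⟩ := (h u).1 hu
      obtain ⟨a', ha', e⟩ := (h' _).1 hu'
      obtain rfl := (opair_inj.1 e).1
      exact set_ext fun p => by rw [h, h'])
  refine ⟨P, c, hy, hP, hc, hP', fun b hb hne => ?_, fun b hb v hv w hw h1 h2 => ?_⟩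
  · obtain ⟨t, ht, h⟩ := hmem b hb hne
    obtain ⟨u, hu, huc, -⟩ := hc' t ht
    obtain ⟨a, ha, rfl⟩ := (h u).1 hu
    exact ⟨a, ha, huc⟩
  · obtain ⟨t, ht, h⟩ := hmem b hb (fun h0 => not_mem_emp v (h0 ▸ hv))
    obtain ⟨u, -, -, hu⟩ := hc' t ht
    have e1 := hu _ ((h _).2 ⟨v, hv, rfl⟩) h1
    have e2 := hu _ ((h _).2 ⟨w, hw, rfl⟩) h2
    exact (opair_inj.1 (e1.trans e2.symm)).2

variable {h h' ξ η η' v v' : V}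

theorem Step.congr (H : Step P c y h ξ v) (e : ∀ ζ ∈ ξ, ∀ a, opair ζ a ∈ h ↔ opair ζ a ∈ h') :
    Step P c y h' ξ v := by
  obtain ⟨b, hb, h1, h2, h3⟩ := H
  refine ⟨b, hb, h1, h2, fun a ha => (h3 a ha).trans (not_congr ?_)⟩
  exact exists_congr fun ζ => and_congr_right fun hζ => e ζ hζ a

theorem Step.unique (hC : ChoiceData A P c y) (H : Step P c y h ξ v) (H' : Step P c y h ξ v') :
    v = v' := by
  obtain ⟨b, hb, h1, h2, h3⟩ := H
  obtain ⟨b', hb', h1', h2', h3'⟩ := H'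
  have hs := ((hC.power b).1 hb).2
  have hs' := ((hC.power b').1 hb').2
  have : b = b' := set_ext fun a =>
    ⟨fun ha => (h3' a (hs a ha)).2 ((h3 a (hs a ha)).1 ha),
      fun ha => (h3 a (hs' a ha)).2 ((h3' a (hs' a ha)).1 ha)⟩
  subst this
  exact hC.unique b hb v h1 v' h1' h2 h2'

theorem Step.mem (hC : ChoiceData A P c y) (H : Step P c y h ξ v) : v ∈ y := by
  obtain ⟨b, hb, h1, -⟩ := H
  exact ((hC.power b).1 hb).2 v h1

theorem Step.not_mem (hC : ChoiceData A P c y) (H : Step P c y h ξ v) :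
    ∀ ζ ∈ ξ, opair ζ v ∉ h := by
  intro ζ hζ hh
  have hv := H.mem hC
  obtain ⟨b, hb, h1, -, h3⟩ := H
  exact (h3 v hv).1 h1 ⟨ζ, hζ, hh⟩

/-- As long as `y` is not exhausted, a further element can be chosen. -/
theorem ChoiceData.exists_step (hA : IsModel A) (hC : ChoiceData A P c y) (hh : h ∈ A) (hξ : ξ ∈ A)
    (hne : ∃ a ∈ y, ∀ ζ ∈ ξ, opair ζ a ∉ h) : ∃ v, Step P c y h ξ v := by
  obtain ⟨b, hb, hb'⟩ := hA.separation (fun _ a w => ∼(bex (w 0) fun ζ => pairMem ζ a (w 1)))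
    ![ξ, h]
    (by simp [Fin.forall_fin_two, hh, hξ]) (P := fun a => ¬ ∃ ζ ∈ ξ, opair ζ a ∈ h)
    (fun k z w xs hq => by simp [hq]) hC.mem_y
  have hbP : b ∈ P := (hC.power b).2 ⟨hb, fun a ha => ((hb' a).1 ha).1⟩
  obtain ⟨a, ha, h1⟩ := hne
  have hab : a ∈ b := (hb' a).2 ⟨ha, fun ⟨ζ, hζ, h2⟩ => h1 ζ hζ h2⟩
  obtain ⟨v, hv, hvc⟩ := hC.exists_choice b hbP (fun h0 => not_mem_emp a (h0 ▸ hab))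
  exact ⟨v, b, hbP, hv, hvc, fun a ha => (hb' a).trans (and_iff_right ha)⟩

theorem Good.step (H : Good P c y h η) (hv : opair ξ v ∈ h) : Step P c y h ξ v := by
  obtain ⟨w, -, hw, hs⟩ := H.2.2 ξ (H.2.1.mem hv).1
  rwa [H.2.1.funOn.2.2 _ _ _ hv hw]

theorem Good.agree (hC : ChoiceData A P c y) (H : Good P c y h η) (H' : Good P c y h' η') :
    ∀ ξ ∈ η, ξ ∈ η' → ∀ v, opair ξ v ∈ h ↔ opair ξ v ∈ h' := by
  refine H.2.1.funOn.agree H.1 H'.1 H'.2.1.funOn fun γ hγ hγ' ih v hv => ?_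
  obtain ⟨w, -, hw, hs⟩ := H'.2.2 γ hγ'
  rwa [((H.step hv).congr ih).unique hC hs]

theorem Good.injective (hC : ChoiceData A P c y) (H : Good P c y h η) {ζ : V}
    (h1 : opair ξ v ∈ h) (h2 : opair ζ v ∈ h) : ξ = ζ := by
  rcases (H.1.mem (H.2.1.mem h1).1).trichotomy (H.1.mem (H.2.1.mem h2).1) with h' | h' | h'
  · exact ((H.step h2).not_mem hC ξ h' h1).elim
  · exact h'
  · exact ((H.step h1).not_mem hC ζ h' h2).elim

theorem Good.restr (H : Good P c y h η) (hξ : ξ ∈ η) :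
    Good P c y (restr h ξ) ξ := by
  have hs : ∀ x ∈ ξ, x ∈ η := fun x hx => H.1.mem_trans hξ hx
  refine ⟨H.1.mem hξ, (H.2.1.funOn.restr hs).isFun fun x z hz =>
    (H.2.1.mem (opair_mem_restr.1 hz).1).2, fun ζ hζ => ?_⟩
  obtain ⟨v, hv, h1, h2⟩ := H.2.2 ζ (hs ζ hζ)
  refine ⟨v, hv, by simp [h1, hζ], h2.congr fun x hx a => ?_⟩
  simp [(H.1.mem hξ).mem_trans hζ hx]

/-- The range of an enumeration determines its length. -/
theorem Good.not_mem_of_range (hC : ChoiceData A P c y) (H : Good P c y h η)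
    (H' : Good P c y h' η')
    (hr : ∀ a ∈ y, (∃ ξ ∈ η', opair ξ a ∈ h') → ∃ ξ ∈ η, opair ξ a ∈ h) : η ∉ η' := by
  intro hη
  obtain ⟨v, hv, h1, h2⟩ := H'.2.2 η hη
  obtain ⟨ξ, hξ, h3⟩ := hr v hv ⟨η, hη, h1⟩
  exact h2.not_mem hC ξ hξ ((H.agree hC H' ξ hξ (H'.1.mem_trans hη hξ) v).1 h3)

theorem IsModel.restr_mem (hA : IsModel A) (hh : h ∈ A) (hξ : ξ ∈ A) : restr h ξ ∈ A := by
  obtain ⟨r, hr, hr'⟩ := hA.separation (fun _ p w => bex (w 0) fun x => ex fun u => isPair p x u)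
    ![ξ]
    (by simpa using hξ) (P := fun p => ∃ x ∈ ξ, ∃ u ∈ A, p = opair x u)
    (fun k z w xs hq => by
      simp [hq]
      exact exists_congr fun x => and_congr_right fun _ =>
        ⟨fun ⟨u, hu⟩ => ⟨u.val, u.prop, hu⟩, fun ⟨u, hu, e⟩ => ⟨⟨u, hu⟩, e⟩⟩) hh
  have : LocalZFC.restr h ξ = r := set_ext fun p => by
    rw [mem_restr, hr']
    refine and_congr_right fun hp => exists_congr fun x => and_congr_right fun _ =>
      ⟨fun ⟨u, hu⟩ => ⟨u, ?_, hu⟩, fun ⟨u, _, hu⟩ => ⟨u, hu⟩⟩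
    exact (hA.cls.of_opair_mem hh (hu ▸ hp)).2
  exact this ▸ hr

/-- Some enumeration exhausts `y`. Otherwise the ordinals `η` with an enumeration of length `η` form
a set `T` by Replacement, being determined by subsets of `y`; the chosen elements at all stages in
`T` form an enumeration of length `T`, whence `T ∈ T`. -/
theorem ChoiceData.exists_good (hA : IsModel A) (hC : ChoiceData A P c y) :
    ∃ η h, Good P c y h η ∧ ∀ a ∈ y, ∃ ξ, opair ξ a ∈ h := by
  by_contra! hno
  obtain ⟨T, hT, hT'⟩ := hA.replacement (fun _ u v w => ex fun h => goodFml (w 0) (w 1) (w 2) h v ⊓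
      ball (w 2) fun a => a ∈ₛ u ⇔ bex v fun ξ => pairMem ξ a h) ![P, c, y]
    (by simp [Fin.forall_fin_succ, hC.mem_P, hC.mem_y, hC.mem_c])
    (P := fun u v => ∃ h ∈ A, Good P c y h v ∧ ∀ a ∈ y, a ∈ u ↔ ∃ ξ ∈ v, opair ξ a ∈ h)
    (fun k u v w xs hq => by
      simp [hq]
      exact ⟨fun ⟨h, hh⟩ => ⟨h.val, h.prop, hh⟩, fun ⟨h, hh, hh'⟩ => ⟨⟨h, hh⟩, hh'⟩⟩)
    hC.mem_P (fun u hu v hv w hw ⟨h, hh, H, e⟩ ⟨h', hh', H', e'⟩ => by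
      rcases H.1.trichotomy H'.1 with h1 | h1 | h1
      · exact (H.not_mem_of_range hC H' (fun a ha h2 => (e a ha).1 ((e' a ha).2 h2)) h1).elim
      · exact h1
      · exact (H'.not_mem_of_range hC H (fun a ha h2 => (e' a ha).1 ((e a ha).2 h2)) h1).elim)
  have hTiff : ∀ v, v ∈ T ↔ v ∈ A ∧ ∃ h ∈ A, Good P c y h v := by
    intro v
    rw [hT']
    refine and_congr_right fun hv => ⟨fun ⟨u, hu, h, hh, H, _⟩ => ⟨h, hh, H⟩, fun ⟨h, hh, H⟩ => ?_⟩
    obtain ⟨u, hu, hu'⟩ := hA.separation (fun _ a w => bex (w 0) fun ξ => pairMem ξ a (w 1)) ![v, h]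
      (by simp [Fin.forall_fin_two, hh, hv]) (P := fun a => ∃ ξ ∈ v, opair ξ a ∈ h)
      (fun k z w xs hq => by simp [hq]) hC.mem_y
    exact ⟨u, (hC.power u).2 ⟨hu, fun a ha => ((hu' a).1 ha).1⟩, h, hh, H,
      fun a ha => (hu' a).trans (and_iff_right ha)⟩
  have hTtr : Tr T := by
    intro v hv x hx
    obtain ⟨hvA, h, hh, H⟩ := (hTiff v).1 hv
    have hxA := hA.tr _ hvA _ hx
    exact (hTiff x).2 ⟨hxA, _, hA.restr_mem hh hxA, H.restr hx⟩
  have hTo : IsOrd T := isOrd_of_tr hTtr fun v hv => by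
    obtain ⟨-, h, -, H⟩ := (hTiff v).1 hv
    exact H.1
  obtain ⟨W, hW, hW'⟩ := hA.exists_pairs (hA.pre.un_mem hT hC.mem_y)
  obtain ⟨g, hg, hg'⟩ := hA.separation (fun _ p w => bex (w 3) fun ξ => bex (w 2) fun v =>
      ex fun h => isPair p ξ v ⊓ goodFml (w 0) (w 1) (w 2) h ξ ⊓
        stepFml (w 0) (w 1) (w 2) h ξ v) ![P, c, y, T]
    (by simp [Fin.forall_fin_succ, hC.mem_P, hC.mem_y, hC.mem_c, hT])
    (P := fun p => ∃ ξ ∈ T, ∃ v ∈ y, ∃ h ∈ A, p = opair ξ v ∧ Good P c y h ξ ∧ Step P c y h ξ v)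
    (fun k p w xs hq => by
      simp only [realize_bex, realize_ex, FirstOrder.Language.BoundedFormula.realize_inf,
        realize_isPair, realize_goodFml, realize_stepFml, Fin.snoc_last, Fin.snoc_castSucc, hq,
        exists_prop, and_assoc]
      refine exists_congr fun ξ => and_congr_right fun _ => exists_congr fun v =>
        and_congr_right fun _ => ?_
      exact ⟨fun ⟨h, hh⟩ => ⟨h.val, h.prop, hh⟩, fun ⟨h, hh, hh'⟩ => ⟨⟨h, hh⟩, hh'⟩⟩) hW
  have hgiff : ∀ ξ v, opair ξ v ∈ g ↔ ξ ∈ T ∧ ∃ h ∈ A, Good P c y h ξ ∧ Step P c y h ξ v := by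
    intro ξ v
    rw [hg']
    constructor
    · rintro ⟨-, ξ', hξ, v', hv, h, hh, e, H, hs⟩
      obtain ⟨rfl, rfl⟩ := opair_inj.1 e
      exact ⟨hξ, h, hh, H, hs⟩
    · rintro ⟨hξ, h, hh, H, hs⟩
      have hv := hs.mem hC
      exact ⟨hW' _ (by simp [hξ]) _ (by simp [hv]), ξ, hξ, v, hv, h, hh, rfl, H, hs⟩
  have hgfun : FunOn g T := by
    refine ⟨fun p hp => ?_, fun ξ hξ => ?_, fun ξ v w h1 h2 => ?_⟩
    · obtain ⟨-, ξ, hξ, v, hv, h, hh, e, H, hs⟩ := (hg' p).1 hp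
      exact ⟨ξ, hξ, v, e⟩
    · obtain ⟨hξA, h, hh, H⟩ := (hTiff ξ).1 hξ
      obtain ⟨a, ha, h1⟩ := hno ξ h H
      obtain ⟨v, hv⟩ := hC.exists_step hA hh hξA ⟨a, ha, fun ζ _ => h1 ζ⟩
      exact ⟨v, (hgiff ξ v).2 ⟨hξ, h, hh, H, hv⟩⟩
    · obtain ⟨hξ, h, hh, H, hs⟩ := (hgiff _ _).1 h1
      obtain ⟨-, h', hh', H', hs'⟩ := (hgiff _ _).1 h2
      exact (hs.congr fun ζ hζ => H.agree hC H' ζ hζ hζ).unique hC hs'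
  have hgood : Good P c y g T := by
    refine ⟨hTo, hgfun.isFun fun ξ v h1 => ?_, fun ξ hξ => ?_⟩
    · obtain ⟨-, h, -, -, hs⟩ := (hgiff _ _).1 h1
      exact hs.mem hC
    · obtain ⟨v, hv⟩ := hgfun.2.1 ξ hξ
      obtain ⟨-, h, hh, H, hs⟩ := (hgiff _ _).1 hv
      refine ⟨v, hs.mem hC, hv, hs.congr fun ζ hζ a => ?_⟩
      have hζT := hTtr _ hξ _ hζ
      -- The enumeration of length `ξ` and `g` agree at `ζ`, by the enumeration of length `ζ`.
      have hforward : ∀ a, opair ζ a ∈ h → opair ζ a ∈ g := fun a ha =>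
        (hgiff _ _).2 ⟨hζT, _, hA.restr_mem hh (hA.tr _ hT _ hζT), H.restr hζ,
          (H.step ha).congr fun x hx b => by simp [hx]⟩
      refine ⟨hforward a, fun ha => ?_⟩
      obtain ⟨b, hb⟩ := H.2.1.funOn.2.1 ζ hζ
      rwa [hgfun.2.2 _ _ _ ha (hforward b hb)]
  exact not_mem_self T ((hTiff T).2 ⟨hT, g, hg, hgood⟩)

/-- Every set is the injective image of an ordinal. -/
theorem exists_enumeration (y : V) : ∃ η h : V, IsOrd η ∧ IsFun h η y ∧
    (∀ a ∈ y, ∃ ξ, opair ξ a ∈ h) ∧ ∀ ξ ζ a, opair ξ a ∈ h → opair ζ a ∈ h → ξ = ζ := by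
  obtain ⟨A, hy, hA⟩ := exists_model y
  obtain ⟨P, c, hC⟩ := hA.exists_choiceData hy
  obtain ⟨η, h, H, hs⟩ := hC.exists_good hA
  exact ⟨η, h, H.1, H.2.1, hs, fun ξ ζ a h1 h2 => H.injective hC h1 h2⟩

end WellOrder

/-! ### The greatest cardinality and the Tall Model Axiom -/

/-- There is a greatest cardinality. -/
def GreatestCard (V : Type*) [setLang.Structure V] [V ⊨ LZFC] : Prop :=
  ∃ κ : V, IsOrd κ ∧ ∀ y, ∃ f, IsInj f y κ

/-- The Tall Model Axiom. -/
def TallModels (V : Type*) [setLang.Structure V] [V ⊨ LZFC] : Prop :=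
  ∀ κ : V, IsOrd κ → ∃ α : V, IsOrd α ∧ κ ∈ α ∧ ∀ δ : V, IsOrd δ → (α ∈ δ ∨ α = δ) →
    ∃ M : V, IsModel M ∧ δ ∈ M ∧ (∃ f ∈ M, IsInj f κ α) ∧ ¬ ∃ f ∈ M, IsInj f α κ

/-- Every set is constructible. -/
def Constructible (V : Type*) [setLang.Structure V] [V ⊨ LZFC] : Prop :=
  ∀ x : V, ∃ α y f : V, IsOrd α ∧ LSeq f (suc α) ∧ opair α y ∈ f ∧ x ∈ y

section Realize

variable {n : ℕ} {v : Empty → V} {xs : Fin n → V}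

theorem realize_cardLE_univ {a b : Fin n} :
    (cardLE a b).Realize v xs ↔ ∃ f, IsInj f (xs a) (xs b) := by
  rw [realize_univ]
  simp [cardLE]
  exact ⟨fun ⟨f, hf⟩ => ⟨f.val, hf⟩, fun ⟨f, hf⟩ => ⟨toUniv f, hf⟩⟩

theorem realize_isOrd_univ {a : Fin n} : (isOrd a).Realize v xs ↔ IsOrd (xs a) := by
  rw [realize_univ]
  simp

theorem realize_isOmega_univ {a : Fin n} :
    (isOmega a).Realize v xs ↔ ∀ x, x ∈ xs a ↔ IsNat x := by
  rw [realize_univ]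
  simp [isOmega]
  exact ⟨fun h x => h (toUniv x), fun h x => h x.val⟩

theorem realize_isL_univ {y a : Fin n} : (isL y a).Realize v xs ↔
    IsOrd (xs a) ∧ ∃ f, LSeq f (suc (xs a)) ∧ opair (xs a) (xs y) ∈ f := by
  rw [realize_univ]
  simp [isL]
  refine fun _ => ⟨?_, ?_⟩
  · rintro ⟨β, f, ⟨h1, h2⟩, h3⟩
    exact ⟨f.val, h1 ▸ h2, h3⟩
  · rintro ⟨f, h2, h3⟩
    exact ⟨toUniv _, toUniv f, ⟨rfl, h2⟩, h3⟩

theorem realize_relativize_cardLT {M a b : Fin n} (hM : IsModel (xs M)) (ha : xs a ∈ xs M)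
    (hb : xs b ∈ xs M) : (relativize M (cardLT a b)).Realize v xs ↔
      (∃ f ∈ xs M, IsInj f (xs a) (xs b)) ∧ ¬ ∃ f ∈ xs M, IsInj f (xs b) (xs a) := by
  have h : (cardLT a b : Fml n) = rename ![a, b] (cardLT 0 1) := (rename_cardLT ![a, b] 0 1).symm
  rw [h]
  refine (realize_relativize_rename _ _ _ _ hM.tr ![⟨xs a, ha⟩, ⟨xs b, hb⟩]
    (fun i => by fin_cases i <;> rfl)).trans ?_
  have key : ∀ (m : ℕ) (c d : Fin m) (ys : Fin m → (TransClass.ofSet (xs M) hM.tr).Elts),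
      (cardLT c d).Realize Empty.elim ys ↔
        (∃ f ∈ xs M, IsInj f (ys c).val (ys d).val) ∧
          ¬ ∃ f ∈ xs M, IsInj f (ys d).val (ys c).val := by
    intro m c d ys
    have hex : ∀ Q : V → Prop, (∃ f : (TransClass.ofSet (xs M) hM.tr).Elts, Q f.val) ↔
        ∃ f ∈ xs M, Q f := fun Q =>
      ⟨fun ⟨f, hf⟩ => ⟨f.val, f.prop, hf⟩, fun ⟨f, hf, hf'⟩ => ⟨⟨f, hf⟩, hf'⟩⟩
    simp only [cardLT, cardLE, FirstOrder.Language.BoundedFormula.realize_inf,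
      FirstOrder.Language.BoundedFormula.realize_not, realize_ex, realize_isInj, Fin.snoc_last,
      Fin.snoc_castSucc]
    exact and_congr (hex fun f => IsInj f (ys c).val (ys d).val)
      (not_congr (hex fun f => IsInj f (ys d).val (ys c).val))
  exact key 2 0 1 _

theorem realize_GC {xs : Fin 0 → V} :
    FirstOrder.Language.BoundedFormula.Realize GC v xs ↔ GreatestCard V := by
  simp only [GC, GreatestCard, realize_ex, FirstOrder.Language.BoundedFormula.realize_inf,
    realize_isOrd_univ, realize_all, realize_cardLE_univ, Fin.snoc_last, Fin.snoc_castSucc]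

theorem realize_VeqL {xs : Fin 0 → V} :
    FirstOrder.Language.BoundedFormula.Realize VeqL v xs ↔ Constructible V := by
  simp only [VeqL, Constructible, realize_ex, FirstOrder.Language.BoundedFormula.realize_inf,
    realize_isL_univ, realize_all, realize_mem, Fin.snoc_last, Fin.snoc_castSucc]
  refine forall_congr' fun x => exists_congr fun α => exists_congr fun y => ?_
  exact ⟨fun ⟨⟨h1, f, h2, h3⟩, h4⟩ => ⟨f, h1, h2, h3, h4⟩,
    fun ⟨f, h1, h2, h3, h4⟩ => ⟨⟨h1, f, h2, h3⟩, h4⟩⟩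

theorem realize_TMA {xs : Fin 0 → V} :
    FirstOrder.Language.BoundedFormula.Realize TMA v xs ↔ TallModels V := by
  simp only [TMA, TallModels, realize_ex, FirstOrder.Language.BoundedFormula.realize_inf,
    FirstOrder.Language.BoundedFormula.realize_imp, FirstOrder.Language.BoundedFormula.realize_sup,
    realize_isOrd_univ, realize_all, realize_mem, realize_eq, realize_isModelZFC, Fin.snoc_last,
    Fin.snoc_castSucc, and_assoc, and_imp]
  refine forall_congr' fun κ => forall_congr' fun _ => exists_congr fun α => and_congr_right
    fun _ => and_congr_right fun hκ => forall_congr' fun δ => forall_congr' fun _ =>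
    forall_congr' fun hαδ => exists_congr fun M => and_congr_right fun hM => and_congr_right
    fun hδ => ?_
  have hα : α ∈ M := by
    rcases hαδ with h | rfl
    exacts [hM.tr _ hδ _ h, hδ]
  have hκM : κ ∈ M := hM.tr _ hα _ hκ
  refine (realize_relativize_cardLT (by simpa only [Fin.snoc_last, Fin.snoc_castSucc] using hM)
    (by simpa only [Fin.snoc_last, Fin.snoc_castSucc] using hκM)
    (by simpa only [Fin.snoc_last, Fin.snoc_castSucc] using hα)).trans ?_
  simp only [Fin.snoc_last, Fin.snoc_castSucc]

end Realize

/-- The identity injects a subset of `b` into `b`, inside every model containing the subset. -/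
theorem IsModel.exists_isInj_of_subset {A a b : V} (hA : IsModel A) (ha : a ∈ A)
    (h : ∀ x ∈ a, x ∈ b) : ∃ f ∈ A, IsInj f a b := by
  obtain ⟨W, hW, hW'⟩ := hA.exists_pairs ha
  obtain ⟨f, hf, hf'⟩ := hA.separation (fun _ p w => bex (w 0) fun x => isPair p x x) ![a]
    (by simpa using ha) (P := fun p => ∃ x ∈ a, p = opair x x) (fun k z w xs hq => by simp [hq]) hW
  have hiff : ∀ x y, opair x y ∈ f ↔ x ∈ a ∧ y = x := by
    intro x y
    rw [hf']
    constructor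
    · rintro ⟨-, z, hz, e⟩
      obtain ⟨rfl, rfl⟩ := opair_inj.1 e
      exact ⟨hz, rfl⟩
    · rintro ⟨hx, rfl⟩
      exact ⟨hW' _ hx _ hx, y, hx, rfl⟩
  refine ⟨f, hf, ⟨fun p hp => ?_, fun x hx => ⟨x, h x hx, (hiff x x).2 ⟨hx, rfl⟩⟩,
    fun x _ y _ z _ h1 h2 => ?_⟩, fun x _ y _ z _ h1 h2 => ?_⟩
  · obtain ⟨-, x, hx, rfl⟩ := (hf' p).1 hp
    exact ⟨x, hx, x, h x hx, rfl⟩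
  · rw [((hiff _ _).1 h1).2, ((hiff _ _).1 h2).2]
  · rw [← ((hiff _ _).1 h1).2, ← ((hiff _ _).1 h2).2]

/-- If `h` enumerates `y` along `η`, then an injection of `η` into `κ` yields one of `y`. -/
theorem exists_isInj_of_enumeration {η h y i κ : V} (hh : IsFun h η y)
    (hs : ∀ a ∈ y, ∃ ξ, opair ξ a ∈ h) (hinj : ∀ ξ ζ a, opair ξ a ∈ h → opair ζ a ∈ h → ξ = ζ)
    (hi : IsInj i η κ) : ∃ f, IsInj f y κ := by
  obtain ⟨A, hU, hA⟩ := exists_model (un y κ)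
  obtain ⟨W, -, hW⟩ := hA.exists_pairs hU
  have hsep : Sep fun p => ∃ a ∈ y, ∃ k ∈ κ, ∃ ξ ∈ η, p = opair a k ∧ opair ξ a ∈ h ∧
      opair ξ k ∈ i := by
    refine Sep.of_formula (fun _ p w => bex (w 0) fun a => bex (w 1) fun k => bex (w 2) fun ξ =>
      isPair p a k ⊓ pairMem ξ a (w 3) ⊓ pairMem ξ k (w 4)) ![y, κ, η, h, i] fun D m z w xs hq => ?_
    simp only [realize_bex, FirstOrder.Language.BoundedFormula.realize_inf, realize_pairMem,
      realize_isPair, Fin.snoc_last, Fin.snoc_castSucc, hq, exists_prop, and_assoc]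
    rfl
  obtain ⟨f, hf⟩ := hsep W
  have hiff : ∀ a k, opair a k ∈ f ↔ ∃ ξ, opair ξ a ∈ h ∧ opair ξ k ∈ i := by
    intro a k
    rw [hf]
    constructor
    · rintro ⟨-, a', -, k', -, ξ, -, e, h1, h2⟩
      obtain ⟨rfl, rfl⟩ := opair_inj.1 e
      exact ⟨ξ, h1, h2⟩
    · rintro ⟨ξ, h1, h2⟩
      have ha := (hh.mem h1).2
      have hk := (hi.1.mem h2).2
      exact ⟨hW _ (by simp [ha]) _ (by simp [hk]), a, ha, k, hk, ξ, (hh.mem h1).1, rfl, h1, h2⟩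
  refine ⟨f, ⟨fun p hp => ?_, fun a ha => ?_, fun a _ k _ l _ h1 h2 => ?_⟩,
    fun a _ b _ k hk h1 h2 => ?_⟩
  · obtain ⟨-, a, ha, k, hk, -, -, e, -⟩ := (hf p).1 hp
    exact ⟨a, ha, k, hk, e⟩
  · obtain ⟨ξ, hξ⟩ := hs a ha
    obtain ⟨k, hk, hξk⟩ := hi.1.2.1 ξ (hh.mem hξ).1
    exact ⟨k, hk, (hiff a k).2 ⟨ξ, hξ, hξk⟩⟩
  · obtain ⟨ξ, h3, h4⟩ := (hiff _ _).1 h1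
    obtain ⟨ζ, h5, h6⟩ := (hiff _ _).1 h2
    obtain rfl := hinj _ _ _ h3 h5
    exact hi.1.funOn.2.2 _ _ _ h4 h6
  · obtain ⟨ξ, h3, h4⟩ := (hiff _ _).1 h1
    obtain ⟨ζ, h5, h6⟩ := (hiff _ _).1 h2
    obtain rfl := hi.2 ξ (hh.mem h3).1 ζ (hh.mem h5).1 k hk h4 h6
    exact hh.funOn.2.2 _ _ _ h3 h5

/-- A constructible injection of `α` into the greatest cardinal `κ` belongs to every sufficiently
tall model, so that tall models cannot believe `|κ| < |α|`. -/
theorem not_tallModels (hL : Constructible V) (hG : GreatestCard V) : ¬ TallModels V := by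
  intro hT
  obtain ⟨κ, hκ, hκ'⟩ := hG
  obtain ⟨α, hα, -, hα'⟩ := hT κ hκ
  obtain ⟨f, hf⟩ := hκ' α
  obtain ⟨β, y, g, hβ, hg, hy, hfy⟩ := hL f
  obtain ⟨δ, hδ, hαδ, hβδ⟩ : ∃ δ, IsOrd δ ∧ (α ∈ δ ∨ α = δ) ∧ (β ∈ δ ∨ β = δ) := by
    rcases hα.trichotomy hβ with h | rfl | h
    · exact ⟨β, hβ, .inl h, .inr rfl⟩
    · exact ⟨α, hα, .inr rfl, .inr rfl⟩
    · exact ⟨α, hα, .inr rfl, .inl h⟩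
  obtain ⟨M, hM, hδM, -, hno⟩ := hα' δ hδ hαδ
  have hβM : β ∈ M := by
    rcases hβδ with h | rfl
    exacts [hM.tr _ hδM _ h, hδM]
  have hgM : g ∈ M := hM.lSeq_mem hβ.suc (hM.pre.suc_mem hβM) hg
  have hyM : y ∈ M := (hM.cls.of_opair_mem hgM hy).2
  exact hno ⟨f, hM.tr _ hyM _ hfy, hf⟩

/-- Without a greatest cardinality, some `y` does not inject into `κ`; then neither does the ordinal
of an enumeration of `y`, and no model contains an injection. -/
theorem tallModels_of_not_greatestCard (hG : ¬ GreatestCard V) : TallModels V := by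
  intro κ hκ
  obtain ⟨y, hy⟩ : ∃ y : V, ∀ f, ¬ IsInj f y κ := by
    by_contra! h
    exact hG ⟨κ, hκ, h⟩
  obtain ⟨η, h, hη, hh, hs, hinj⟩ := exists_enumeration y
  have hno : ∀ i, ¬ IsInj i η κ := fun i hi => by
    obtain ⟨f, hf⟩ := exists_isInj_of_enumeration hh hs hinj hi
    exact hy f hf
  have hκη : κ ∈ η := by
    by_contra hc
    obtain ⟨A, hηA, hA⟩ := exists_model η
    obtain ⟨f, -, hf⟩ := hA.exists_isInj_of_subset (b := κ) hηA fun x hx => by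
      rcases hκ.trichotomy hη with h' | rfl | h'
      exacts [(hc h').elim, hx, hκ.mem_trans h' hx]
    exact hno f hf
  refine ⟨η, hη, hκη, fun δ hδ hηδ => ?_⟩
  obtain ⟨M, hδM, hM⟩ := exists_model δ
  have hηM : η ∈ M := by
    rcases hηδ with h' | rfl
    exacts [hM.tr _ hδM _ h', hδM]
  exact ⟨M, hM, hδM, hM.exists_isInj_of_subset (hM.tr _ hηM _ hκη) fun x hx => hη.mem_trans hκη hx,
    fun ⟨f, _, hf⟩ => hno f hf⟩

/-- If every set is countable, then `ω` is the greatest cardinality. -/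
theorem greatestCard_of_allCountable {v : Empty → V} {xs : Fin 0 → V}
    (h : FirstOrder.Language.BoundedFormula.Realize allCountable v xs) : GreatestCard V := by
  simp only [allCountable, realize_all, realize_ex, FirstOrder.Language.BoundedFormula.realize_inf,
    realize_isOmega_univ, realize_cardLE_univ, Fin.snoc_last, Fin.snoc_castSucc] at h
  obtain ⟨w, hw, -⟩ := h (emp V)
  refine ⟨w, isOrd_of_tr (fun x hx y hy => ?_) fun x hx => ((hw x).1 hx).1, fun y => ?_⟩
  · rw [hw] at hx ⊢
    exact hx.mem hy
  · obtain ⟨w', hw', hf⟩ := h y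
    rwa [set_ext fun x => (hw x).trans (hw' x).symm]

end LocalZFC

theorem proposition5p9 :
    ((LocalZFC.LZFC ∪ {LocalZFC.GC, LocalZFC.VeqL}) ⊨ᵇ ∼LocalZFC.TMA) ∧
    ((LocalZFC.LZFC ∪ {LocalZFC.allCountable, LocalZFC.VeqL}) ⊨ᵇ ∼LocalZFC.TMA) ∧
    ((LocalZFC.LZFC ∪ {LocalZFC.VeqL}) ⊨ᵇ ∼LocalZFC.TMA ⇔ LocalZFC.GC) := by
  refine ⟨fun V v xs => ?_, fun V v xs => ?_, fun V v xs => ?_⟩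
  · have hV : V ⊨ LocalZFC.LZFC := V.is_model.mono Set.subset_union_left
    have hG := V.is_model.realize_of_mem LocalZFC.GC (by simp)
    have hL := V.is_model.realize_of_mem LocalZFC.VeqL (by simp)
    rw [FirstOrder.Language.BoundedFormula.realize_not, LocalZFC.realize_TMA]
    exact LocalZFC.not_tallModels (LocalZFC.realize_VeqL.1 hL) (LocalZFC.realize_GC.1 hG)
  · have hV : V ⊨ LocalZFC.LZFC := V.is_model.mono Set.subset_union_left
    have hC := V.is_model.realize_of_mem LocalZFC.allCountable (by simp)
    have hL := V.is_model.realize_of_mem LocalZFC.VeqL (by simp)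
    rw [FirstOrder.Language.BoundedFormula.realize_not, LocalZFC.realize_TMA]
    exact LocalZFC.not_tallModels (LocalZFC.realize_VeqL.1 hL)
      (LocalZFC.greatestCard_of_allCountable hC)
  · have hV : V ⊨ LocalZFC.LZFC := V.is_model.mono Set.subset_union_left
    have hL := V.is_model.realize_of_mem LocalZFC.VeqL (by simp)
    rw [FirstOrder.Language.BoundedFormula.realize_iff,
      FirstOrder.Language.BoundedFormula.realize_not, LocalZFC.realize_TMA, LocalZFC.realize_GC]
    exact ⟨fun h => by_contra fun hG => h (LocalZFC.tallModels_of_not_greatestCard hG),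
      LocalZFC.not_tallModels (LocalZFC.realize_VeqL.1 hL)⟩
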